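/- Let $n\ge 1$, $1<p\le 2$, $\frac1p+\frac1{p'}=1$ and $s\ge n(p'-2)/p'$. Let $\mathcal F$ denote the Fourier transform, $\mathcal F f(\xi)=\int f(x)e^{-2\pi i x\cdot\xi}\,dx$, and put $$\|f\|_{H^{r,q}(\mathbb R^n)}=\big\|\mathcal F^{-1}\big((1+|\xi|^2)^{r/2}\mathcal F f\big)\big\|_{L^q(\mathbb R^n)},$$ with value $\infty$ for tempered distributions $f$ for which $\mathcal F^{-1}((1+|\xi|^2)^{r/2}\mathcal F f)\notin L^q$. For $\theta\in S^{n-1}$ and $\sigma\in\mathbb R$ let $Rf(\sigma,\theta)=\int_{x\cdot\theta=\sigma}f(x)\,dx$ be the Radon transform. For a sinogram $g(\sigma,\theta)$ let $$\|g\|_{R^{r,q}_t(\mathbb R\times S^{n-1})}=\Big(\int_{S^{n-1}}\int_{\mathbb R}\big|v_{r,t}(\tau)\,(\mathcal F_\sigma g)(\tau,\theta)\big|^q\,d\tau\,d\theta\Big)^{1/q},\qquad v_{r,t}(\tau)=(1+\tau^2)^{r/2}\Big(\frac{|\tau|}{(1+\tau^2)^{1/2}}\Big)^t,$$ where $\mathcal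 F_\sigma$ is the one-dimensional Fourier transform in $\sigma$, and let $R^{r,q}_t(\mathbb R\times S^{n-1})$ be the completion of the Schwartz space $\mathcal S(\mathbb R\times S^{n-1})$ under this norm. Then there are constants $c,C>0$ depending only on $n,p,s$ such that $$c\,\|f\|_{H^{s-n(p'-2)/p',\,p'}(\mathbb R^n)}\;\le\;\|Rf\|_{R^{s+(n-1)/p',\,p'}_{(np'-n-1)/p'}(\mathbb R\times S^{n-1})}\;\le\;C\,\|f\|_{H^{s,p}(\mathbb R^n)}\qquad(\ast)$$ in the following two senses. 1. $(\ast)$ holds for every complex-valued $f\in L^1(\mathbb R^n)$, with $Rf$ defined by the integral over hyperplanes (values $\infty$ being allowed). 2. Let $\mathcal R$ be the closure, in $\mathcal S'(\mathbb R^n)\times R^{s+(n-1)/p',p'}_{(np'-n-1)/p'}$ (with the topology of pointwise convergence on $\mathcal S'$), of the graph $\{(f,Rf): f\in\mathcal S(\mathbb R^n)\}$. For every $f\in H^{s,p}(\mathbb R^n)$ there is exactly one $g=:Rf$ with $(f,g)\in\mathcal R$; and $(\ast)$ holds, with $g$ in place of $Rf$, for every $(f,g)\in\mathcal R$. -/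

import Mathlib

open MeasureTheory
open scoped ENNReal NNReal SchwartzMap FourierTransform

noncomputable section

namespace RadonBessel

/-- Euclidean space `ℝⁿ`. -/
abbrev E (n : ℕ) : Type := EuclideanSpace ℝ (Fin n)

/-- The unit sphere `S^{n-1}` of `ℝⁿ`. -/
abbrev Sph (n : ℕ) : Type := Metric.sphere (0 : E n) 1

/-- The surface measure on `S^{n-1}` (counting measure on the two points of `S⁰` if `n = 1`). -/
def sphereMeasure (n : ℕ) : Measure (Sph n) := (volume : Measure (E n)).toSphere

/-- The measure `dσ dθ` on the cylinder `ℝ × S^{n-1}`. -/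
def cylinderMeasure (n : ℕ) : Measure (ℝ × Sph n) :=
  (volume : Measure ℝ).prod (sphereMeasure n)

/-- The Radon transform `Rf(σ, θ) = ∫_{x·θ = σ} f(x) dx`. The hyperplane `x·θ = σ` is
parametrized isometrically by `y ↦ σ θ + y` with `y` in the orthogonal complement of `θ`, which
carries the Lebesgue measure of an orthonormal basis. -/
def radon {n : ℕ} (f : E n → ℂ) (σ : ℝ) (θ : Sph n) : ℂ :=
  ∫ y : (Submodule.span ℝ {(θ : E n)})ᗮ, f (σ • (θ : E n) + (y : E n))
    ∂((stdOrthonormalBasis ℝ (Submodule.span ℝ {(θ : E n)})ᗮ).toBasis.addHaar)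

/-- The weight `v_{s,t}(ξ) = (1 + |ξ|²)^{s/2} (|ξ| / (1 + |ξ|²)^{1/2})^t`. -/
def vWeight {V : Type*} [NormedAddCommGroup V] (s t : ℝ) (ξ : V) : ℝ :=
  (1 + ‖ξ‖ ^ 2) ^ (s / 2) * (‖ξ‖ / (1 + ‖ξ‖ ^ 2) ^ (1 / 2 : ℝ)) ^ t

/-- The norm `‖h‖_{S^{s,p}_t} = ‖v_{s,t} 𝓕 h‖_{L^p}` of a function `h` of one real variable. -/
def sNorm (s t : ℝ) (p : ℝ≥0∞) (h : ℝ → ℂ) : ℝ≥0∞ :=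
  eLpNorm (fun τ : ℝ => (vWeight s t τ : ℂ) * 𝓕 h τ) p volume

/-- The norm `‖g‖_{R^{s,p}_t} = (∫_{S^{n-1}} ‖g(·, θ)‖_{S^{s,p}_t(ℝ)}^p dθ)^{1/p}` of a sinogram
(for finite `p`), with value `∞` allowed. -/
def sinogramNorm {n : ℕ} (s t : ℝ) (p : ℝ≥0∞) (g : ℝ → Sph n → ℂ) : ℝ≥0∞ :=
  (∫⁻ θ : Sph n, sNorm s t p (fun σ => g σ θ) ^ p.toReal ∂(sphereMeasure n)) ^ (1 / p.toReal)

/-- The function `(τ, θ) ↦ v_{s,t}(τ) (𝓕_σ g)(τ, θ)` on the cylinder, whose `L^p`-norm with respect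
to `dτ dθ` is the sinogram norm of `g`. -/
def weightedFourier {n : ℕ} (s t : ℝ) (g : ℝ → Sph n → ℂ) (z : ℝ × Sph n) : ℂ :=
  (vWeight s t z.1 : ℂ) * 𝓕 (fun σ => g σ z.2) z.1

/-- The Schwartz functions on the cylinder `ℝ × S^{n-1}`: the restrictions of Schwartz functions
on the ambient space `ℝ × ℝⁿ`. -/
def IsSchwartzSinogram {n : ℕ} (g : ℝ → Sph n → ℂ) : Prop :=
  ∃ G : 𝓢(ℝ × E n, ℂ), ∀ (σ : ℝ) (θ : Sph n), g σ θ = G (σ, (θ : E n))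

/-- The sinogram space `R^{s,p}_t(ℝ × S^{n-1})`, the completion of the Schwartz functions on the
cylinder under the sinogram norm. Since `g ↦ v_{s,t} 𝓕_σ g` is a linear isometry from the
Schwartz functions with this norm into the Banach space `L^p(dτ dθ)`, the completion is realized
as the closure of its range, with the `L^p`-norm. -/
def SinogramSpace (n : ℕ) (s t : ℝ) (p : ℝ≥0∞) [Fact (1 ≤ p)] :
    Submodule ℂ (Lp ℂ p (cylinderMeasure n)) :=
  (Submodule.span ℂ {G : Lp ℂ p (cylinderMeasure n) |
    ∃ g : ℝ → Sph n → ℂ, IsSchwartzSinogram g ∧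
      (G : ℝ × Sph n → ℂ) =ᵐ[cylinderMeasure n] weightedFourier s t g}).topologicalClosure

/-- `G ∈ R^{s,p}_t` is the Radon transform of the tempered distribution `u`: the pair `(u, G)` lies
in the closure, in `𝓢' × R^{s,p}_t`, of the graph of the Radon transform on Schwartz functions. -/
def HasRadonTransform {n : ℕ} {s t : ℝ} {p : ℝ≥0∞} [Fact (1 ≤ p)]
    (u : 𝓢'(E n, ℂ)) (G : SinogramSpace n s t p) : Prop :=
  (u, G) ∈ closure {x : 𝓢'(E n, ℂ) × SinogramSpace n s t p |
    ∃ f : 𝓢(E n, ℂ), x.1 = (f : 𝓢'(E n, ℂ)) ∧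
      ((x.2 : Lp ℂ p (cylinderMeasure n)) : ℝ × Sph n → ℂ)
        =ᵐ[cylinderMeasure n] weightedFourier s t (radon f)}

/-- The Bessel potential norm `‖u‖_{H^{s,p}} = ‖𝓕⁻¹ ((1 + |ξ|²)^{s/2} 𝓕 u)‖_{L^p}` of a tempered
distribution, equal to `∞` unless `𝓕⁻¹ ((1 + |ξ|²)^{s/2} 𝓕 u)` is given by a (necessarily unique)
element of `L^p`. -/
def besselNorm {n : ℕ} (s : ℝ) (p : ℝ≥0∞) [Fact (1 ≤ p)] (u : 𝓢'(E n, ℂ)) : ℝ≥0∞ :=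
  ⨅ (g : Lp ℂ p (volume : Measure (E n)))
    (_ : TemperedDistribution.besselPotential (E n) ℂ s u = (g : 𝓢'(E n, ℂ))), ‖g‖ₑ

end RadonBessel

end

/-! The Fourier slice theorem says `𝓕_σ (Rf)(τ, θ) = 𝓕 f (τθ)`. Hence the sinogram norm of `Rf` is
the `L^{p'}` norm of `v_{r,t} 𝓕 f` for the image of `dτ dθ` under `(τ, θ) ↦ τθ`, which is `2
|ξ|^{-(n-1)} dξ`. Here `r = s + (n-1)/p'` and `t = (np'-n-1)/p'`. The Radon transform disappears,
and both bounds become weighted inequalities for the Fourier transform.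

Upper bound (`exists_vWeight_fourier_extension`): write `f = ⟨D⟩^{-s} h`. The `p'`-th power of the
weight, times the density, is `2 (|ξ|²/(1+|ξ|²))^{n(p'-2)/2} ≤ 2`, so Hausdorff–Young applied to `h`
suffices.

Lower bound (`exists_Lp_repr_polarKernel`): for Schwartz `φ`, the pairing of `⟨D⟩^{r-t} f` with `φ`
equals the pairing, in the polar measure, of `v_{r,t} 𝓕 f` with the kernel `½ |ξ|^{n-1-t} 𝓕⁻¹ φ`.
Paley's inequality bounds this kernel in `L^p` by `‖φ‖_p`, and duality of `L^p` and `L^{p'}`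
finishes. Note that `r - t = s - n(p'-2)/p'`.

Hausdorff–Young and Paley are both cases of Hörmander's inequality `∫ |𝓕 f|^p w^{2-p} ≤ C ∫ |f|^p`
for `w` in the unit ball of weak `L¹` (`lintegral_fourier_rpow_mul_le`). It is proved by real
interpolation between `L¹ → L^∞` and Plancherel.

For the closed graph, the pairing identity and the fact that the sinogram is a function of `τθ` are
closed conditions, so they pass from Schwartz functions to every limit pair
(`exists_polar_of_hasRadonTransform`). The identity determines the sinogram, which gives uniqueness.
Existence follows from the upper bound and density of Schwartz functions in `L^p`. -/

namespace RadonBessel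

/-! ### The Fourier integral on `L¹` and Plancherel on `L¹ ∩ L²` -/

section Plancherel

variable {V : Type*} [NormedAddCommGroup V] [InnerProductSpace ℝ V] [FiniteDimensional ℝ V]
  [MeasurableSpace V] [BorelSpace V]

/-- A locally integrable function whose integrals against all Schwartz functions vanish is zero
almost everywhere. -/
theorem ae_eq_zero_of_integral_schwartz_mul_eq_zero {μ : Measure V} {f : V → ℂ}
    (hf : LocallyIntegrable f μ) (h : ∀ ψ : 𝓢(V, ℂ), ∫ x, ψ x * f x ∂μ = 0) :
    ∀ᵐ x ∂μ, f x = 0 := by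
  refine ae_eq_zero_of_integral_contDiff_smul_eq_zero hf fun g hg hc => ?_
  have hg₁ : HasCompactSupport (Complex.ofRealCLM ∘ g) := hc.comp_left rfl
  have hg₂ : ContDiff ℝ (⊤ : ℕ∞) (Complex.ofRealCLM ∘ g) := by fun_prop
  simpa using h (hg₁.toSchwartzMap hg₂)

theorem continuous_fourier_of_integrable {f : V → ℂ} (hf : Integrable f) :
    Continuous (𝓕 f) :=
  VectorFourier.fourierIntegral_continuous Real.continuous_fourierChar
    (by exact continuous_inner) hf

theorem norm_fourier_le_integral_norm (f : V → ℂ) (ξ : V) : ‖𝓕 f ξ‖ ≤ ∫ x, ‖f x‖ :=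
  VectorFourier.norm_fourierIntegral_le_integral_norm _ _ _ f ξ

theorem integral_fourier_mul_eq_of_integrable {f g : V → ℂ} (hf : Integrable f)
    (hg : Integrable g) : ∫ ξ, 𝓕 f ξ * g ξ = ∫ x, f x * 𝓕 g x := by
  have := VectorFourier.integral_fourierIntegral_smul_eq_flip (L := innerₗ V)
    (μ := (volume : Measure V)) (ν := (volume : Measure V)) Real.continuous_fourierChar
    (by exact continuous_inner) hf hg
  simp only [flip_innerₗ, smul_eq_mul] at this
  exact this

theorem fourier_add_of_integrable {f g : V → ℂ} (hf : Integrable f) (hg : Integrable g) (ξ : V) :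
    𝓕 (fun x => f x + g x) ξ = 𝓕 f ξ + 𝓕 g ξ := by
  have := VectorFourier.fourierIntegral_add (L := innerₗ V) (μ := (volume : Measure V))
    Real.continuous_fourierChar (by exact continuous_inner) hf hg
  exact (congrFun this ξ)

/-- Plancherel's theorem for functions in `L¹ ∩ L²`. -/
theorem eLpNorm_fourier_two {f : V → ℂ} (hf : Integrable f) (hf2 : MemLp f 2) :
    eLpNorm (𝓕 f) 2 volume = eLpNorm f 2 volume := by
  set F : Lp ℂ 2 (volume : Measure V) := hf2.toLp
  -- The abstract `L²` transform and the Fourier integral agree because both move onto the test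
  -- function as `∫ f 𝓕ψ`.
  have key : ∀ᵐ ξ, (𝓕 F : Lp ℂ 2 (volume : Measure V)) ξ - 𝓕 f ξ = 0 := by
    have hl1 : LocallyIntegrable (𝓕 F : Lp ℂ 2 (volume : Measure V)) :=
      (Lp.memLp _).locallyIntegrable (by norm_num)
    have hl2 : LocallyIntegrable (𝓕 f) (volume : Measure V) :=
      (continuous_fourier_of_integrable hf).locallyIntegrable
    refine ae_eq_zero_of_integral_schwartz_mul_eq_zero (hl1.sub hl2) fun ψ => ?_
    have h1 : ∫ x, ψ x * (𝓕 F : Lp ℂ 2 (volume : Measure V)) x = ∫ x, ψ x * 𝓕 f x := by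
      have := congrArg (fun u : 𝓢'(V, ℂ) => u ψ) (Lp.fourier_toTemperedDistribution_eq F)
      simp only [TemperedDistribution.fourier_apply, Lp.toTemperedDistribution_apply,
        smul_eq_mul] at this
      rw [← this]
      have h3 : ∫ x, (𝓕 ψ) x * F x = ∫ x, f x * (𝓕 (ψ : V → ℂ)) x := by
        refine integral_congr_ae ?_
        filter_upwards [hf2.coeFn_toLp] with x hx
        rw [hx, mul_comm, SchwartzMap.fourier_coe]
      rw [h3, ← integral_fourier_mul_eq_of_integrable hf ψ.integrable]
      simp_rw [mul_comm]
    have i1 : Integrable fun x => ψ x * (𝓕 F : Lp ℂ 2 (volume : Measure V)) x :=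
      (ψ.memLp 2 volume).integrable_mul (Lp.memLp _)
    have i2 : Integrable fun x => ψ x * 𝓕 f x :=
      ψ.integrable.mul_bdd (c := ∫ x, ‖f x‖)
        (continuous_fourier_of_integrable hf).aestronglyMeasurable
        (Filter.Eventually.of_forall fun x => norm_fourier_le_integral_norm f x)
    simp only [mul_sub]
    rw [integral_sub i1 i2, h1, sub_self]
  have e1 : eLpNorm (𝓕 f) 2 volume = ‖(𝓕 F : Lp ℂ 2 (volume : Measure V))‖ₑ := by
    rw [Lp.enorm_def]
    exact eLpNorm_congr_ae (by filter_upwards [key] with x hx; exact (sub_eq_zero.1 hx).symm)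
  have e2 : ‖(𝓕 F : Lp ℂ 2 (volume : Measure V))‖ₑ = ‖F‖ₑ := by
    rw [← ofReal_norm, ← ofReal_norm, Lp.norm_fourier_eq]
  rw [e1, e2, Lp.enorm_def]
  exact eLpNorm_congr_ae hf2.coeFn_toLp

theorem lintegral_enorm_fourier_sq {f : V → ℂ} (hf : Integrable f) (hf2 : MemLp f 2) :
    ∫⁻ ξ, ‖𝓕 f ξ‖ₑ ^ (2 : ℝ) = ∫⁻ x, ‖f x‖ₑ ^ (2 : ℝ) := by
  have := eLpNorm_fourier_two hf hf2
  rw [eLpNorm_eq_lintegral_rpow_enorm_toReal (by norm_num) (by norm_num),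
    eLpNorm_eq_lintegral_rpow_enorm_toReal (by norm_num) (by norm_num)] at this
  simpa using ENNReal.rpow_left_injective (x := (1 / (2 : ℝ≥0∞).toReal)) (by norm_num) this

end Plancherel

/-! ### Power integrals and the two Fubini identities of real interpolation -/

section RealIntegrals

open Set

theorem lintegral_Ioo_rpow {a b : ℝ} (ha : -1 < a) (hb : 0 ≤ b) :
    ∫⁻ t in Ioo 0 b, ENNReal.ofReal (t ^ a) = ENNReal.ofReal (b ^ (a + 1) / (a + 1)) := by
  have hi : IntegrableOn (fun t : ℝ => t ^ a) (Ioo 0 b) :=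
    ((intervalIntegral.intervalIntegrable_rpow' ha (a := 0) (b := b)).1).mono_set
      Ioo_subset_Ioc_self
  rw [← ofReal_integral_eq_lintegral_ofReal hi
    (by filter_upwards [ae_restrict_mem measurableSet_Ioo] with t ht using
      Real.rpow_nonneg ht.1.le _), ← integral_Ioc_eq_integral_Ioo,
    ← intervalIntegral.integral_of_le hb, integral_rpow (Or.inl ha),
    Real.zero_rpow (by linarith), sub_zero]

theorem lintegral_Ici_rpow {a b : ℝ} (ha : a < -1) (hb : 0 < b) :
    ∫⁻ t in Ici b, ENNReal.ofReal (t ^ a) = ENNReal.ofReal (b ^ (a + 1) / (-(a + 1))) := by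
  have hi : IntegrableOn (fun t : ℝ => t ^ a) (Ioi b) := integrableOn_Ioi_rpow_of_lt ha hb
  rw [setLIntegral_congr Ioi_ae_eq_Ici.symm, ← ofReal_integral_eq_lintegral_ofReal hi
    (by filter_upwards [ae_restrict_mem measurableSet_Ioi] with t ht using
      Real.rpow_nonneg (hb.trans ht).le _), integral_Ioi_rpow_of_lt ha hb]
  congr 1
  rw [div_neg, neg_div]

variable {α : Type*} [MeasurableSpace α] {μ : Measure α} [SFinite μ] {g : α → ℝ}

/-- By Fubini the inner integral is `∫_0^{g} t^{p-2} dt = g^{p-1}/(p-1)`, convergent at `0` because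
`p > 1`. It sums the contributions of the large parts of `f` over all truncation heights. -/
theorem lintegral_rpow_mul_lintegral_indicator_lt {p : ℝ} (hp : 1 < p) (hg : Measurable g)
    (hg0 : ∀ x, 0 ≤ g x) :
    ∫⁻ t in Ioi (0 : ℝ), ENNReal.ofReal (t ^ (p - 2)) *
        ∫⁻ x in {x | t < g x}, ENNReal.ofReal (g x) ∂μ
      = ENNReal.ofReal (1 / (p - 1)) * ∫⁻ x, ENNReal.ofReal (g x ^ p) ∂μ := by
  have hm : MeasurableSet {z : ℝ × α | z.1 < g z.2} :=
    measurableSet_lt measurable_fst (hg.comp measurable_snd)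
  have h1 : ∀ t : ℝ, ENNReal.ofReal (t ^ (p - 2)) *
        ∫⁻ x in {x | t < g x}, ENNReal.ofReal (g x) ∂μ =
      ∫⁻ x, {z : ℝ × α | z.1 < g z.2}.indicator
        (fun z => ENNReal.ofReal (z.1 ^ (p - 2)) * ENNReal.ofReal (g z.2)) (t, x) ∂μ := by
    intro t
    rw [← lintegral_indicator (measurableSet_lt measurable_const hg),
      ← lintegral_const_mul' _ _ ENNReal.ofReal_ne_top]
    refine lintegral_congr fun x => ?_
    by_cases h : t < g x <;> simp [indicator, h]
  simp_rw [h1]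
  rw [lintegral_lintegral_swap]
  · rw [← lintegral_const_mul' _ _ ENNReal.ofReal_ne_top]
    refine lintegral_congr fun x => ?_
    have h2 : ∀ t : ℝ, {z : ℝ × α | z.1 < g z.2}.indicator
        (fun z => ENNReal.ofReal (z.1 ^ (p - 2)) * ENNReal.ofReal (g z.2)) (t, x) =
        ENNReal.ofReal (g x) * (Iio (g x)).indicator (fun t => ENNReal.ofReal (t ^ (p - 2))) t := by
      intro t
      by_cases h : t < g x <;> simp [indicator, h, mul_comm]
    simp_rw [h2]
    rw [lintegral_const_mul' _ _ ENNReal.ofReal_ne_top,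
      setLIntegral_indicator measurableSet_Iio,
      Set.inter_comm, Ioi_inter_Iio, lintegral_Ioo_rpow (by linarith) (hg0 x),
      ← ENNReal.ofReal_mul (hg0 x), ← ENNReal.ofReal_mul (by
        rw [one_div, inv_nonneg]; linarith)]
    congr 1
    rcases (hg0 x).eq_or_lt with h0 | h0
    · rw [← h0, Real.zero_rpow (by linarith : p ≠ 0)]; simp
    · rw [show p - 2 + 1 = p - 1 by ring, show g x ^ p = g x ^ (1 + (p - 1)) by ring_nf,
        Real.rpow_add h0, Real.rpow_one]
      ring
  · refine Measurable.aemeasurable ?_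
    refine Measurable.indicator ?_ hm
    fun_prop

/-- The counterpart for the small parts: Fubini leaves `∫_g^∞ t^{p-3} dt = g^{p-2}/(2-p)`,
convergent at infinity because `p < 2`. -/
theorem lintegral_rpow_mul_lintegral_indicator_le {p : ℝ} (hp : 1 < p) (hp2 : p < 2)
    (hg : Measurable g) (hg0 : ∀ x, 0 ≤ g x) :
    ∫⁻ t in Ioi (0 : ℝ), ENNReal.ofReal (t ^ (p - 3)) *
        ∫⁻ x in {x | g x ≤ t}, ENNReal.ofReal (g x ^ (2 : ℝ)) ∂μ
      = ENNReal.ofReal (1 / (2 - p)) * ∫⁻ x, ENNReal.ofReal (g x ^ p) ∂μ := by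
  have hm : MeasurableSet {z : ℝ × α | g z.2 ≤ z.1} :=
    measurableSet_le (hg.comp measurable_snd) measurable_fst
  have h1 : ∀ t : ℝ, ENNReal.ofReal (t ^ (p - 3)) *
        ∫⁻ x in {x | g x ≤ t}, ENNReal.ofReal (g x ^ (2 : ℝ)) ∂μ =
      ∫⁻ x, {z : ℝ × α | g z.2 ≤ z.1}.indicator
        (fun z => ENNReal.ofReal (z.1 ^ (p - 3)) * ENNReal.ofReal (g z.2 ^ (2 : ℝ))) (t, x) ∂μ := by
    intro t
    rw [← lintegral_indicator (measurableSet_le hg measurable_const),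
      ← lintegral_const_mul' _ _ ENNReal.ofReal_ne_top]
    refine lintegral_congr fun x => ?_
    by_cases h : g x ≤ t <;> simp [indicator, h]
  simp_rw [h1]
  rw [lintegral_lintegral_swap]
  · rw [← lintegral_const_mul' _ _ ENNReal.ofReal_ne_top]
    refine lintegral_congr fun x => ?_
    have h2 : ∀ t : ℝ, {z : ℝ × α | g z.2 ≤ z.1}.indicator
        (fun z => ENNReal.ofReal (z.1 ^ (p - 3)) * ENNReal.ofReal (g z.2 ^ (2 : ℝ))) (t, x) =
        ENNReal.ofReal (g x ^ (2 : ℝ)) *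
          (Ici (g x)).indicator (fun t => ENNReal.ofReal (t ^ (p - 3))) t := by
      intro t
      by_cases h : g x ≤ t <;> simp [indicator, h, mul_comm]
    simp_rw [h2]
    rw [lintegral_const_mul' _ _ ENNReal.ofReal_ne_top,
      setLIntegral_indicator measurableSet_Ici]
    rcases (hg0 x).eq_or_lt with h0 | h0
    · rw [← h0, Real.zero_rpow (by linarith : p ≠ 0)]; simp
    · rw [Set.inter_eq_left.2 (show Ici (g x) ⊆ Ioi 0 from fun t ht => h0.trans_le ht), lintegral_Ici_rpow (by linarith) h0,
        ← ENNReal.ofReal_mul (by positivity), ← ENNReal.ofReal_mul (by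
        rw [one_div, inv_nonneg]; linarith)]
      congr 1
      rw [show p - 3 + 1 = p - 2 by ring, show g x ^ p = g x ^ (2 + (p - 2)) by ring_nf,
        Real.rpow_add h0, neg_sub]
      ring
  · refine Measurable.aemeasurable ?_
    refine Measurable.indicator ?_ hm
    fun_prop

end RealIntegrals

/-! ### Hörmander's form of the Hausdorff–Young–Paley inequality -/

section Paley

variable {V : Type*} [NormedAddCommGroup V] [InnerProductSpace ℝ V] [FiniteDimensional ℝ V]
  [MeasurableSpace V] [BorelSpace V]

/-- If `t |{w ≥ t}| ≤ 1` for all `t > 0`, then `∫_{w ≤ a} w² ≤ 2a`. -/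
theorem setLIntegral_sq_le {α : Type*} [MeasurableSpace α] {μ : Measure α} {w : α → ℝ}
    (hwm : Measurable w) (hw0 : ∀ x, 0 ≤ w x)
    (hw : ∀ t : ℝ, 0 < t → ENNReal.ofReal t * μ {x | t ≤ w x} ≤ 1) {a : ℝ} (ha : 0 ≤ a) :
    ∫⁻ x in {x | w x ≤ a}, ENNReal.ofReal (w x ^ (2 : ℝ)) ∂μ ≤ ENNReal.ofReal (2 * a) := by
  have hm : MeasurableSet {x | w x ≤ a} := measurableSet_le hwm measurable_const
  set f : α → ℝ := {x | w x ≤ a}.indicator w with hf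
  have hf0 : ∀ x, 0 ≤ f x := fun x => Set.indicator_nonneg (fun x _ => hw0 x) x
  have h1 : ∫⁻ x in {x | w x ≤ a}, ENNReal.ofReal (w x ^ (2 : ℝ)) ∂μ =
      ∫⁻ x, ENNReal.ofReal (f x ^ (2 : ℝ)) ∂μ := by
    rw [← lintegral_indicator hm]
    refine lintegral_congr fun x => ?_
    by_cases h : w x ≤ a <;> simp [hf, Set.indicator, h]
  -- In the layer cake formula the integrand `t μ{f > t}` is at most `1` for `t < a` and vanishes
  -- for `t ≥ a`, since `f ≤ a`.
  rw [h1, lintegral_rpow_eq_lintegral_meas_lt_mul μ (Filter.Eventually.of_forall hf0)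
    (hwm.indicator hm).aemeasurable (by norm_num), ENNReal.ofReal_mul (by norm_num)]
  gcongr
  calc ∫⁻ t in Set.Ioi (0 : ℝ), μ {x | t < f x} * ENNReal.ofReal (t ^ ((2 : ℝ) - 1))
      ≤ ∫⁻ t in Set.Ioi (0 : ℝ), (Set.Iio a).indicator (fun _ => 1) t := by
        refine setLIntegral_mono' measurableSet_Ioi fun t (ht : 0 < t) => ?_
        by_cases hta : t < a
        · rw [Set.indicator_of_mem (by exact hta), mul_comm, show (2 : ℝ) - 1 = 1 by norm_num,
            Real.rpow_one]
          refine le_trans ?_ (hw t ht)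
          gcongr with x
          intro hx
          refine hx.le.trans (Set.indicator_le_self' (fun _ _ => hw0 _) x)
        · have : {x | t < f x} = ∅ := by
            ext x
            simp only [Set.mem_ofPred_eq, Set.mem_empty_iff_false, iff_false, not_lt]
            refine le_trans ?_ (not_lt.1 hta)
            by_cases h : w x ≤ a <;> simp [hf, h, ha]
          simp [this]
    _ = ENNReal.ofReal a := by
        rw [setLIntegral_indicator measurableSet_Iio, Set.inter_comm, Set.Ioi_inter_Iio]
        simp

/-- The weak type estimate behind the Hausdorff–Young–Paley inequality. -/
theorem withDensity_sq_lt_norm_fourier_le {w : V → ℝ} (hwm : Measurable w) (hw0 : ∀ x, 0 ≤ w x)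
    (hw : ∀ t : ℝ, 0 < t → ENNReal.ofReal t * volume {x | t ≤ w x} ≤ 1)
    {f : V → ℂ} (hf : Integrable f) (hf2 : MemLp f 2) (hfm : Measurable f) {t : ℝ} (ht : 0 < t) :
    ∫⁻ ξ in {ξ | t * w ξ < ‖𝓕 f ξ‖ ∧ 0 < w ξ}, ENNReal.ofReal (w ξ ^ (2 : ℝ)) ≤
      ENNReal.ofReal (4 / t) * (∫⁻ x in {x | t < ‖f x‖}, ENNReal.ofReal ‖f x‖) +
      ENNReal.ofReal (4 / t ^ 2) * ∫⁻ x in {x | ‖f x‖ ≤ t}, ENNReal.ofReal (‖f x‖ ^ (2 : ℝ)) := by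
  have hm1 : MeasurableSet {x | t < ‖f x‖} := measurableSet_lt measurable_const hfm.norm
  have hm2 : MeasurableSet {x | ‖f x‖ ≤ t} := measurableSet_le hfm.norm measurable_const
  -- The truncation height equals the level `t`. The large part `f₁` is estimated by `L¹ → L^∞`, the
  -- small part `f₂` by Plancherel.
  set f₁ : V → ℂ := {x | t < ‖f x‖}.indicator f with hf₁
  set f₂ : V → ℂ := {x | ‖f x‖ ≤ t}.indicator f with hf₂
  have i1 : Integrable f₁ := hf.indicator hm1
  have i2 : Integrable f₂ := hf.indicator hm2
  have hsum : f = fun x => f₁ x + f₂ x := by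
    ext x
    rcases lt_or_ge t ‖f x‖ with h | h
    · simp [f₁, f₂, h]
    · simp [f₁, f₂, h]
  set A : ℝ := ∫ x, ‖f₁ x‖ with hA
  have hA0 : 0 ≤ A := integral_nonneg fun _ => norm_nonneg _
  have hFm₂ : Measurable (𝓕 f₂) := (continuous_fourier_of_integrable i2).measurable
  -- If `|𝓕 f| > t w`, then `|𝓕 f₁|` or `|𝓕 f₂|` is at least `t w / 2`. The first case forces `w ≤
  -- 2A/t`, where the weak-type bound gives `∫ w² ≤ 4A/t`; otherwise `w < 2 |𝓕 f₂|/t` and Plancherel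
  -- applies.
  set S₁ : Set V := {ξ | w ξ ≤ 2 * A / t}
  set S₂ : Set V := {ξ | t * w ξ < 2 * ‖𝓕 f₂ ξ‖}
  have hS₂ : MeasurableSet S₂ := measurableSet_lt (hwm.const_mul _) (hFm₂.norm.const_mul _)
  have hsub : {ξ | t * w ξ < ‖𝓕 f ξ‖ ∧ 0 < w ξ} ⊆ S₁ ∪ S₂ := by
    rintro ξ ⟨h1, -⟩
    have h2 : ‖𝓕 f ξ‖ ≤ ‖𝓕 f₁ ξ‖ + ‖𝓕 f₂ ξ‖ := by
      conv_lhs => rw [hsum, fourier_add_of_integrable i1 i2]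
      exact norm_add_le _ _
    have h3 : ‖𝓕 f₁ ξ‖ ≤ A := norm_fourier_le_integral_norm f₁ ξ
    by_cases h4 : w ξ ≤ 2 * A / t
    · exact Or.inl h4
    · right
      rw [le_div_iff₀ ht] at h4
      change t * w ξ < 2 * ‖𝓕 f₂ ξ‖
      linarith
  calc ∫⁻ ξ in {ξ | t * w ξ < ‖𝓕 f ξ‖ ∧ 0 < w ξ}, ENNReal.ofReal (w ξ ^ (2 : ℝ))
      ≤ ∫⁻ ξ in S₁ ∪ S₂, ENNReal.ofReal (w ξ ^ (2 : ℝ)) := lintegral_mono_set hsub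
    _ ≤ (∫⁻ ξ in S₁, ENNReal.ofReal (w ξ ^ (2 : ℝ))) +
        ∫⁻ ξ in S₂, ENNReal.ofReal (w ξ ^ (2 : ℝ)) := lintegral_union_le _ _ _
    _ ≤ _ := by
      refine add_le_add ?_ ?_
      · refine (setLIntegral_sq_le hwm hw0 hw (by positivity)).trans_eq ?_
        have : ∫⁻ x in {x | t < ‖f x‖}, ENNReal.ofReal ‖f x‖ = ENNReal.ofReal A := by
          rw [hA, ofReal_integral_eq_lintegral_ofReal i1.norm
            (Filter.Eventually.of_forall fun _ => norm_nonneg _), ← lintegral_indicator hm1]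
          refine lintegral_congr fun x => ?_
          by_cases h : t < ‖f x‖ <;> simp [f₁, h]
        rw [this, ← ENNReal.ofReal_mul (by positivity)]
        congr 1
        ring
      · calc ∫⁻ ξ in S₂, ENNReal.ofReal (w ξ ^ (2 : ℝ))
            ≤ ∫⁻ ξ in S₂, ENNReal.ofReal (4 / t ^ 2) * ‖𝓕 f₂ ξ‖ₑ ^ (2 : ℝ) := by
              refine setLIntegral_mono' hS₂ fun ξ hξ => ?_
              rw [← ofReal_norm, ENNReal.ofReal_rpow_of_nonneg (norm_nonneg _) (by norm_num),
                ← ENNReal.ofReal_mul (by positivity)]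
              refine ENNReal.ofReal_le_ofReal ?_
              have h5 : w ξ ≤ 2 * ‖𝓕 f₂ ξ‖ / t := by
                rw [le_div_iff₀ ht, mul_comm]; exact le_of_lt hξ
              calc w ξ ^ (2 : ℝ) ≤ (2 * ‖𝓕 f₂ ξ‖ / t) ^ (2 : ℝ) :=
                    Real.rpow_le_rpow (hw0 _) h5 (by norm_num)
                _ = _ := by rw [Real.rpow_two, Real.rpow_two]; ring
          _ ≤ ∫⁻ ξ, ENNReal.ofReal (4 / t ^ 2) * ‖𝓕 f₂ ξ‖ₑ ^ (2 : ℝ) := setLIntegral_le_lintegral _ _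
          _ = _ := by
            rw [lintegral_const_mul' _ _ ENNReal.ofReal_ne_top,
              lintegral_enorm_fourier_sq i2 (hf2.indicator hm2), ← lintegral_indicator hm2]
            congr 1
            refine lintegral_congr fun x => ?_
            by_cases h : ‖f x‖ ≤ t
            · simp only [f₂, Set.indicator, Set.mem_ofPred_eq, h, if_true]
              rw [← ofReal_norm, ENNReal.ofReal_rpow_of_nonneg (norm_nonneg _) (by norm_num)]
            · simp [f₂, h]

/-- The constant in the Hausdorff–Young–Paley inequality. -/
noncomputable def paleyConst (p : ℝ) : ℝ≥0 := (max 1 (p * (4 / (p - 1) + 4 / (2 - p)))).toNNReal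

/-- The Hausdorff–Young–Paley inequality, in Hörmander's form: if `t |{w ≥ t}| ≤ 1` for all
`t > 0`, then `∫ |𝓕 f|^p w^(2 - p) ≤ C ∫ |f|^p`. -/
theorem lintegral_fourier_rpow_mul_le {p : ℝ} (hp : 1 < p) (hp2 : p ≤ 2) {w : V → ℝ}
    (hwm : Measurable w) (hw0 : ∀ x, 0 ≤ w x)
    (hw : ∀ t : ℝ, 0 < t → ENNReal.ofReal t * volume {x | t ≤ w x} ≤ 1)
    {f : V → ℂ} (hf : Integrable f) (hf2 : MemLp f 2) (hfm : Measurable f) :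
    ∫⁻ ξ, ENNReal.ofReal (‖𝓕 f ξ‖ ^ p * w ξ ^ (2 - p)) ≤
      paleyConst p * ∫⁻ x, ENNReal.ofReal (‖f x‖ ^ p) := by
  have hC1 : (1 : ℝ≥0∞) ≤ paleyConst p := by
    rw [paleyConst, ENNReal.ofNNReal_toNNReal, ENNReal.one_le_ofReal]
    exact le_max_left _ _
  -- At `p = 2` this is Plancherel, including the points where `w = 0`. The formula in `paleyConst`
  -- then contains `4/0 = 0`, and the maximum with `1` supplies the constant.
  rcases hp2.eq_or_lt with rfl | hp2
  · simp only [sub_self, Real.rpow_zero, mul_one]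
    have := lintegral_enorm_fourier_sq hf hf2
    simp_rw [← ofReal_norm, ENNReal.ofReal_rpow_of_nonneg (norm_nonneg _)
      (show (0 : ℝ) ≤ 2 by norm_num)] at this
    rw [this]
    exact le_mul_of_one_le_left' hC1
  have hFm : Measurable (𝓕 f) := (continuous_fourier_of_integrable hf).measurable
  have hwpos : MeasurableSet {ξ | 0 < w ξ} := measurableSet_lt measurable_const hwm
  -- With `a = |𝓕 f|/w` the integrand is `a^p` for the measure `w² dξ`. In this measure `f ↦ 𝓕 f /
  -- w` is of weak type `(1,1)` and strong type `(2,2)`. Points with `w = 0` do not contribute,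
  -- since `p < 2`.
  set a : V → ℝ := {ξ | 0 < w ξ}.indicator fun ξ => ‖𝓕 f ξ‖ / w ξ with ha
  have ham : Measurable a := (hFm.norm.div hwm).indicator hwpos
  have ha0 : ∀ ξ, 0 ≤ a ξ := fun ξ =>
    Set.indicator_nonneg (fun ξ _ => div_nonneg (norm_nonneg _) (hw0 ξ)) ξ
  set D : V → ℝ≥0∞ := fun ξ => ENNReal.ofReal (w ξ ^ (2 : ℝ)) with hD
  have hDm : Measurable D := (hwm.pow_const _).ennreal_ofReal
  have e1 : ∫⁻ ξ, ENNReal.ofReal (‖𝓕 f ξ‖ ^ p * w ξ ^ (2 - p)) =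
      ∫⁻ ξ, ENNReal.ofReal (a ξ ^ p) ∂(volume.withDensity D) := by
    rw [lintegral_withDensity_eq_lintegral_mul _ hDm (ham.pow_const _).ennreal_ofReal]
    refine lintegral_congr fun ξ => ?_
    simp only [Pi.mul_apply, hD]
    rw [← ENNReal.ofReal_mul (Real.rpow_nonneg (hw0 _) _)]
    congr 1
    rcases (hw0 ξ).eq_or_lt with h | h
    · rw [← h, Real.zero_rpow (by linarith), Real.zero_rpow (by norm_num)]; simp
    · rw [ha, Set.indicator_of_mem (by exact h), Real.div_rpow (norm_nonneg _) h.le,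
        Real.rpow_sub h]
      ring
  rw [e1, lintegral_rpow_eq_lintegral_meas_lt_mul _ (Filter.Eventually.of_forall ha0)
    ham.aemeasurable (by linarith)]
  have e2 : ∀ t : ℝ, 0 < t → (volume.withDensity D) {ξ | t < a ξ} * ENNReal.ofReal (t ^ (p - 1)) ≤
      ENNReal.ofReal 4 * (ENNReal.ofReal (t ^ (p - 2)) *
        ∫⁻ x in {x | t < ‖f x‖}, ENNReal.ofReal ‖f x‖) +
      ENNReal.ofReal 4 * (ENNReal.ofReal (t ^ (p - 3)) *
        ∫⁻ x in {x | ‖f x‖ ≤ t}, ENNReal.ofReal (‖f x‖ ^ (2 : ℝ))) := by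
    intro t ht
    have hset : {ξ | t < a ξ} = {ξ | t * w ξ < ‖𝓕 f ξ‖ ∧ 0 < w ξ} := by
      ext ξ
      by_cases h : 0 < w ξ
      · simp [ha, h, lt_div_iff₀ h]
      · simp [ha, h, ht.le]
    have hm : MeasurableSet {ξ | t < a ξ} := measurableSet_lt measurable_const ham
    rw [withDensity_apply _ hm, hset]
    refine (mul_le_mul_left (withDensity_sq_lt_norm_fourier_le hwm hw0 hw hf hf2 hfm ht) _).trans ?_
    rw [add_mul]
    refine add_le_add (le_of_eq ?_) (le_of_eq ?_)
    · rw [mul_right_comm, ← ENNReal.ofReal_mul (by positivity), ← mul_assoc,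
        ← ENNReal.ofReal_mul (by norm_num)]
      congr 2
      rw [show p - 1 = (p - 2) + 1 by ring, Real.rpow_add ht, Real.rpow_one]
      field_simp
    · rw [mul_right_comm, ← ENNReal.ofReal_mul (by positivity), ← mul_assoc,
        ← ENNReal.ofReal_mul (by norm_num)]
      congr 2
      rw [show p - 1 = (p - 3) + 2 by ring, Real.rpow_add ht, Real.rpow_two]
      field_simp
  have hgm : Measurable fun x => ‖f x‖ := hfm.norm
  calc ENNReal.ofReal p * ∫⁻ t in Set.Ioi (0 : ℝ),
        (volume.withDensity D) {ξ | t < a ξ} * ENNReal.ofReal (t ^ (p - 1))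
      ≤ ENNReal.ofReal p * ∫⁻ t in Set.Ioi (0 : ℝ),
        (ENNReal.ofReal 4 * (ENNReal.ofReal (t ^ (p - 2)) *
          ∫⁻ x in {x | t < ‖f x‖}, ENNReal.ofReal ‖f x‖) +
        ENNReal.ofReal 4 * (ENNReal.ofReal (t ^ (p - 3)) *
          ∫⁻ x in {x | ‖f x‖ ≤ t}, ENNReal.ofReal (‖f x‖ ^ (2 : ℝ)))) := by
        exact mul_le_mul' le_rfl (setLIntegral_mono' measurableSet_Ioi fun t ht => e2 t ht)
    _ = ENNReal.ofReal p * (ENNReal.ofReal 4 * (ENNReal.ofReal (1 / (p - 1)) *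
          ∫⁻ x, ENNReal.ofReal (‖f x‖ ^ p)) +
        ENNReal.ofReal 4 * (ENNReal.ofReal (1 / (2 - p)) *
          ∫⁻ x, ENNReal.ofReal (‖f x‖ ^ p))) := by
        have hmeas : Measurable fun t : ℝ => ENNReal.ofReal 4 * (ENNReal.ofReal (t ^ (p - 2)) *
            ∫⁻ x in {x | t < ‖f x‖}, ENNReal.ofReal ‖f x‖) := by
          refine Measurable.const_mul (Measurable.mul (by fun_prop) ?_) _
          have : Antitone fun t : ℝ => ∫⁻ x in {x | t < ‖f x‖}, ENNReal.ofReal ‖f x‖ :=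
            fun s t hst => lintegral_mono_set fun x hx => lt_of_le_of_lt hst hx
          exact this.measurable
        rw [lintegral_add_left hmeas, lintegral_const_mul' _ _ ENNReal.ofReal_ne_top,
          lintegral_const_mul' _ _ ENNReal.ofReal_ne_top,
          lintegral_rpow_mul_lintegral_indicator_lt hp hgm fun _ => norm_nonneg _,
          lintegral_rpow_mul_lintegral_indicator_le hp hp2 hgm fun _ => norm_nonneg _]
    _ = ENNReal.ofReal (p * (4 / (p - 1) + 4 / (2 - p))) *
          ∫⁻ x, ENNReal.ofReal (‖f x‖ ^ p) := by
        have h1 : 0 < p - 1 := by linarith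
        have h2 : 0 < 2 - p := by linarith
        rw [ENNReal.ofReal_mul (by linarith), ENNReal.ofReal_add (by positivity) (by positivity),
          show 4 / (p - 1) = 4 * (1 / (p - 1)) by ring, show 4 / (2 - p) = 4 * (1 / (2 - p)) by ring,
          ENNReal.ofReal_mul (by norm_num), ENNReal.ofReal_mul (by norm_num)]
        ring
    _ ≤ _ := by
        gcongr
        rw [paleyConst, ENNReal.ofNNReal_toNNReal]
        exact ENNReal.ofReal_le_ofReal (le_max_right _ _)

end Paley

/-! ### The two choices of weight: Paley and Hausdorff–Young -/

section HausdorffYoung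

variable {V : Type*} [NormedAddCommGroup V] [InnerProductSpace ℝ V] [FiniteDimensional ℝ V]
  [MeasurableSpace V] [BorelSpace V]

/-- Paley's inequality `∫ |𝓕 f|^p |ξ|^(-d (2 - p)) ≤ C ∫ |f|^p` in dimension `d ≥ 1`. -/
theorem exists_lintegral_fourier_rpow_mul_norm_rpow_le {p : ℝ} (hp : 1 < p) (hp2 : p ≤ 2)
    [Nontrivial V] : ∃ C : ℝ≥0, ∀ f : 𝓢(V, ℂ),
      ∫⁻ ξ, ENNReal.ofReal (‖𝓕 (f : V → ℂ) ξ‖ ^ p *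
        ‖ξ‖ ^ (-(Module.finrank ℝ V * (2 - p)) : ℝ)) ≤
      C * ∫⁻ x, ENNReal.ofReal (‖f x‖ ^ p) := by
  set d : ℝ := (Module.finrank ℝ V : ℝ) with hd
  have hd0 : 0 < d := by simpa [hd] using Module.finrank_pos (R := ℝ) (M := V)
  set b : ℝ := volume.real (Metric.ball (0 : V) 1) with hb
  have hb0 : 0 < b := ENNReal.toReal_pos (Metric.measure_ball_pos _ _ one_pos).ne'
    measure_ball_lt_top.ne
  have hbe : volume (Metric.ball (0 : V) 1) = ENNReal.ofReal b := by
    rw [hb, ofReal_measureReal measure_ball_lt_top.ne]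
  -- The normalization by the volume `b` of the unit ball makes the ball containing `{w ≥ t}` have
  -- volume exactly `1/t`. At the origin `w` has the value `0`, because a negative power of `0` is
  -- `0`.
  set w : V → ℝ := fun ξ => b⁻¹ * ‖ξ‖ ^ (-d) with hwdef
  have hwm : Measurable w := by fun_prop
  have hw0 : ∀ ξ, 0 ≤ w ξ := fun ξ => by positivity
  have hw : ∀ t : ℝ, 0 < t → ENNReal.ofReal t * volume {x | t ≤ w x} ≤ 1 := by
    intro t ht
    set r : ℝ := (b⁻¹ / t) ^ d⁻¹ with hr
    have hr0 : 0 ≤ r := by positivity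
    have hrd : r ^ Module.finrank ℝ V = b⁻¹ / t := by
      rw [← Real.rpow_natCast, hr, ← Real.rpow_mul (by positivity), inv_mul_cancel₀ hd0.ne',
        Real.rpow_one]
    have hsub : {x | t ≤ w x} ⊆ Metric.closedBall (0 : V) r := by
      intro x hx
      change t ≤ b⁻¹ * ‖x‖ ^ (-d) at hx
      rw [mem_closedBall_zero_iff]
      rcases (norm_nonneg x).eq_or_lt with h | h
      · rw [← h]; exact hr0
      · rw [Real.rpow_neg h.le, ← div_eq_mul_inv, le_div_comm₀ ht (by positivity)] at hx
        have := Real.rpow_le_rpow (by positivity) hx (inv_nonneg.2 hd0.le)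
        rwa [← Real.rpow_mul h.le, mul_inv_cancel₀ hd0.ne', Real.rpow_one] at this
    calc ENNReal.ofReal t * volume {x | t ≤ w x}
        ≤ ENNReal.ofReal t * volume (Metric.closedBall (0 : V) r) := by gcongr
      _ = ENNReal.ofReal (t * ((b⁻¹ / t) * b)) := by
        rw [Measure.addHaar_closedBall _ _ hr0, hrd, hbe, ← ENNReal.ofReal_mul (by positivity),
          ← ENNReal.ofReal_mul ht.le]
      _ = 1 := by
        rw [show t * ((b⁻¹ / t) * b) = 1 by field_simp, ENNReal.ofReal_one]
      _ ≤ 1 := le_rfl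
  refine ⟨paleyConst p * (b ^ (2 - p)).toNNReal, fun f => ?_⟩
  have key := lintegral_fourier_rpow_mul_le hp hp2 hwm hw0 hw f.integrable (f.memLp 2 volume)
    f.continuous.measurable
  have e : ∀ ξ : V, ENNReal.ofReal (‖𝓕 (f : V → ℂ) ξ‖ ^ p * ‖ξ‖ ^ (-(d * (2 - p)) : ℝ)) =
      ENNReal.ofReal (b ^ (2 - p)) * ENNReal.ofReal (‖𝓕 (f : V → ℂ) ξ‖ ^ p * w ξ ^ (2 - p)) := by
    intro ξ
    rw [← ENNReal.ofReal_mul (by positivity)]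
    congr 1
    rw [hwdef, Real.mul_rpow (by positivity) (by positivity), ← Real.rpow_mul (norm_nonneg _),
      Real.inv_rpow hb0.le, neg_mul]
    have : b ^ (2 - p) ≠ 0 := by positivity
    field_simp
  simp_rw [e]
  rw [lintegral_const_mul' _ _ ENNReal.ofReal_ne_top, ENNReal.coe_mul, mul_comm (paleyConst p : ℝ≥0∞),
    mul_assoc]
  gcongr
  exact le_rfl

theorem holderConjugate_toReal_of_one_lt {p q : ℝ≥0∞} (hpq : p.HolderConjugate q) (hp : 1 < p)
    (hp2 : p ≤ 2) : p.toReal.HolderConjugate q.toReal ∧ 1 < p.toReal ∧ p.toReal ≤ 2 ∧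
      2 ≤ q.toReal ∧ p ≠ ∞ ∧ q ≠ ∞ := by
  have hptop : p ≠ ∞ := ne_top_of_le_ne_top (by norm_num) hp2
  have hqtop : q ≠ ∞ := (hpq.symm.lt_top_iff_one_lt q p).2 hp |>.ne
  have h1 : 1 < p.toReal := by
    rw [← ENNReal.toReal_one]
    exact (ENNReal.toReal_lt_toReal ENNReal.one_ne_top hptop).2 hp
  have h2 : p.toReal ≤ 2 := by
    have := ENNReal.toReal_mono (by norm_num) hp2
    simpa using this
  have h3 : p.toReal⁻¹ + q.toReal⁻¹ = 1 := by
    have := congrArg ENNReal.toReal hpq.inv_add_inv_eq_one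
    rwa [ENNReal.toReal_add (by simpa using hpq.ne_zero) (by simpa using hpq.symm.ne_zero),
      ENNReal.toReal_inv, ENNReal.toReal_inv, ENNReal.toReal_one] at this
  have hc : p.toReal.HolderConjugate q.toReal := Real.holderConjugate_iff.2 ⟨h1, h3⟩
  refine ⟨hc, h1, h2, ?_, hptop, hqtop⟩
  have h4 := hc.mul_eq_add
  have h5 := hc.symm.pos
  nlinarith

/-- The Hausdorff–Young inequality for Schwartz functions, with a constant depending on `p`. -/
theorem eLpNorm_fourier_le {p q : ℝ≥0∞} (hpq : p.HolderConjugate q) (hp : 1 < p) (hp2 : p ≤ 2)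
    (f : 𝓢(V, ℂ)) :
    eLpNorm (𝓕 (f : V → ℂ)) q volume ≤
      (paleyConst p.toReal : ℝ≥0∞) ^ (1 / p.toReal) * eLpNorm f p volume := by
  obtain ⟨hc, hP1, hP2, hQ2, hptop, hqtop⟩ := holderConjugate_toReal_of_one_lt hpq hp hp2
  rw [eLpNorm_eq_lintegral_rpow_enorm_toReal hpq.symm.ne_zero hqtop,
    eLpNorm_eq_lintegral_rpow_enorm_toReal hpq.ne_zero hptop]
  have hfin : ∫⁻ ξ, ‖𝓕 (f : V → ℂ) ξ‖ₑ ^ q.toReal < ∞ := by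
    rw [← SchwartzMap.fourier_coe]
    exact (eLpNorm_lt_top_iff_lintegral_rpow_enorm_lt_top hpq.symm.ne_zero hqtop).1
      ((𝓕 f).eLpNorm_lt_top q volume)
  have hFm : Measurable (𝓕 (f : V → ℂ)) :=
    (continuous_fourier_of_integrable f.integrable).measurable
  set P := p.toReal
  set Q := q.toReal
  simp_rw [← ofReal_norm, ENNReal.ofReal_rpow_of_nonneg (norm_nonneg _) hc.symm.nonneg] at hfin ⊢
  simp_rw [ENNReal.ofReal_rpow_of_nonneg (norm_nonneg _) hc.nonneg]
  set M := ∫⁻ ξ, ENNReal.ofReal (‖𝓕 (f : V → ℂ) ξ‖ ^ Q) with hM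
  rcases eq_or_ne M 0 with h0 | h0
  · rw [h0, ENNReal.zero_rpow_of_pos (by have := hc.symm.pos; positivity)]
    exact zero_le
  set m := M.toReal with hm
  have hm0 : 0 < m := ENNReal.toReal_pos h0 hfin.ne
  have hMm : M = ENNReal.ofReal m := (ENNReal.ofReal_toReal hfin.ne).symm
  -- The weight is `|𝓕 f|^q` itself, normalized to have integral `1`, so Chebyshev's inequality is
  -- the weak-type hypothesis. As `p + q(2-p) = q`, the inequality reads `m^{p-1} ≤ C ∫ |f|^p`, and
  -- `(p-1)/p = 1/q`. Finiteness of `m` comes from `𝓕 f` being Schwartz.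
  have hwm : Measurable fun ξ => m⁻¹ * ‖𝓕 (f : V → ℂ) ξ‖ ^ Q :=
    (hFm.norm.pow_const _).const_mul _
  have hint : ∫⁻ ξ, ENNReal.ofReal (m⁻¹ * ‖𝓕 (f : V → ℂ) ξ‖ ^ Q) = 1 := by
    simp_rw [ENNReal.ofReal_mul (inv_nonneg.2 hm0.le)]
    rw [lintegral_const_mul' _ _ ENNReal.ofReal_ne_top, ← hM, hMm,
      ← ENNReal.ofReal_mul (inv_nonneg.2 hm0.le), inv_mul_cancel₀ hm0.ne', ENNReal.ofReal_one]
  have key := lintegral_fourier_rpow_mul_le hP1 hP2 hwm (fun ξ => by positivity) (fun t ht => by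
      rw [← hint]
      refine le_trans ?_ (mul_meas_ge_le_lintegral hwm.ennreal_ofReal (ENNReal.ofReal t))
      gcongr with x
      exact fun hx => ENNReal.ofReal_le_ofReal hx) f.integrable (f.memLp 2 volume)
    f.continuous.measurable
  have e : ∀ ξ : V, ENNReal.ofReal (‖𝓕 (f : V → ℂ) ξ‖ ^ P *
      (m⁻¹ * ‖𝓕 (f : V → ℂ) ξ‖ ^ Q) ^ (2 - P)) =
      ENNReal.ofReal (m⁻¹ ^ (2 - P)) * ENNReal.ofReal (‖𝓕 (f : V → ℂ) ξ‖ ^ Q) := by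
    intro ξ
    rw [← ENNReal.ofReal_mul (by positivity), Real.mul_rpow (by positivity) (by positivity)]
    congr 1
    rcases (norm_nonneg (𝓕 (f : V → ℂ) ξ)).eq_or_lt with h | h
    · rw [← h, Real.zero_rpow hc.ne_zero, Real.zero_rpow hc.symm.ne_zero]; simp
    · rw [mul_left_comm, ← Real.rpow_mul h.le, ← Real.rpow_add h,
        show P + Q * (2 - P) = Q by linear_combination -hc.mul_eq_add]
  simp_rw [e] at key
  rw [lintegral_const_mul' _ _ ENNReal.ofReal_ne_top, ← hM, hMm,
    ← ENNReal.ofReal_mul (by positivity)] at key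
  have e2 : m⁻¹ ^ (2 - P) * m = m ^ (P - 1) := by
    rw [Real.inv_rpow hm0.le, ← Real.rpow_neg hm0.le]
    nth_rw 2 [← Real.rpow_one m]
    rw [← Real.rpow_add hm0]
    ring_nf
  rw [e2] at key
  rw [hMm, ← ENNReal.mul_rpow_of_nonneg _ _ (by have := hc.pos; positivity)]
  refine le_trans (le_of_eq ?_) (ENNReal.rpow_le_rpow key (by have := hc.pos; positivity))
  have := hc.pos
  have := hc.symm.pos
  rw [ENNReal.ofReal_rpow_of_pos hm0, ENNReal.ofReal_rpow_of_pos (by positivity),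
    ← Real.rpow_mul hm0.le]
  congr 2
  field_simp
  linear_combination -hc.mul_eq_add

end HausdorffYoung

/-! ### The dual of `L^p` for `1 < p ≤ 2`, through Riesz representation in `L²` -/

section Duality

variable {V : Type*} [NormedAddCommGroup V] [InnerProductSpace ℝ V] [FiniteDimensional ℝ V]
  [MeasurableSpace V] [BorelSpace V]

/-- For `p ≤ 2`, a continuous functional on `L^p` is given by integration against a function `g`,
at least on functions that decay sufficiently fast. -/
theorem exists_integral_repr_of_rapid_decay {p : ℝ≥0∞} [Fact (1 ≤ p)] (hp2 : p ≤ 2)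
    (Λ : Lp ℂ p (volume : Measure V) →L[ℂ] ℂ) :
    ∃ (k : ℕ) (g : V → ℂ), Measurable g ∧ ∀ (h : V → ℂ) (hh : MemLp h p volume),
      MemLp (fun x => ((1 + ‖x‖ : ℝ) : ℂ) ^ k * h x) 2 volume →
        Λ hh.toLp = ∫ x, h x * g x := by
  have hp0 : p ≠ 0 := (zero_lt_one.trans_le Fact.out).ne'
  -- With `1/r + 1/2 = 1/p`, multiplication by a decaying `η = (1+|x|)^{-k} ∈ L^r` maps `L²` to
  -- `L^p`. The functional pulls back to the Hilbert space `L²`, and dividing its Riesz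
  -- representative by `η` gives `g`. For `p = 2` one has `r = ∞`.
  set r : ℝ≥0∞ := (p⁻¹ - 2⁻¹)⁻¹ with hr
  have : ENNReal.HolderTriple r 2 p := ⟨by
    rw [hr, inv_inv, tsub_add_cancel_of_le (ENNReal.inv_le_inv.2 hp2)]⟩
  have : Fact (1 ≤ r) := ⟨by
    rw [hr, ENNReal.one_le_inv]
    exact tsub_le_self.trans (ENNReal.inv_le_one.2 Fact.out)⟩
  obtain ⟨k, hk⟩ := Measure.HasTemperateGrowth.exists_eLpNorm_lt_top r
    (μ := (volume : Measure V)) inferInstance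
  have hη : MemLp (fun x : V => (((1 + ‖x‖) ^ (-k : ℝ) : ℝ) : ℂ)) r volume := by
    refine MemLp.ofReal ⟨?_, hk⟩
    exact Measurable.aestronglyMeasurable (by fun_prop)
  set Φ := (ContinuousLinearMap.mul ℂ ℂ).holderL (volume : Measure V) r 2 p hη.toLp with hΦ
  set Ψ : Lp ℂ 2 (volume : Measure V) →L[ℂ] ℂ := Λ ∘L Φ with hΨ
  set g₀ := (InnerProductSpace.toDual ℂ (Lp ℂ 2 (volume : Measure V))).symm Ψ with hg₀
  refine ⟨k, fun x => ((1 + ‖x‖ : ℝ) : ℂ) ^ k * (starRingEnd ℂ) (g₀ x), ?_, fun h hh hk2 => ?_⟩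
  · refine Measurable.mul (by fun_prop) ?_
    exact (Complex.continuous_conj.measurable).comp (Lp.stronglyMeasurable g₀).measurable
  · have e1 : Φ hk2.toLp = hh.toLp := by
      refine Lp.ext ?_
      filter_upwards [(ContinuousLinearMap.mul ℂ ℂ).coeFn_holder (r := p) hη.toLp hk2.toLp,
        hη.coeFn_toLp, hk2.coeFn_toLp, hh.coeFn_toLp] with x h1 h2 h3 h4
      have hx : (0 : ℝ) < 1 + ‖x‖ := by positivity
      rw [show (Φ hk2.toLp) x = ((ContinuousLinearMap.mul ℂ ℂ).holder p hη.toLp hk2.toLp) x from rfl,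
        h1, h2, h3, h4, ContinuousLinearMap.mul_apply', ← mul_assoc,
        Real.rpow_neg hx.le, Real.rpow_natCast, ← Complex.ofReal_pow, ← Complex.ofReal_mul,
        inv_mul_cancel₀ (by positivity), Complex.ofReal_one, one_mul]
    have e2 : Λ hh.toLp = inner ℂ g₀ hk2.toLp := by
      rw [← e1, hg₀, InnerProductSpace.toDual_symm_apply]
      rfl
    rw [e2, L2.inner_def]
    refine integral_congr_ae ?_
    filter_upwards [hk2.coeFn_toLp] with x hx
    rw [hx, RCLike.inner_apply]
    ring

/-- If integration against `g` is bounded by `K ‖h‖_p` on truncated multiples of `|g|^(q-1)`,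
then `‖g‖_q ≤ K`. -/
theorem lintegral_rpow_le_of_integral_mul_le {P Q : ℝ} (hc : P.HolderConjugate Q) (hQ2 : 2 ≤ Q)
    {g : V → ℂ} (hg : Measurable g) {K : ℝ} (hK : 0 ≤ K)
    (h : ∀ (h : V → ℂ) (N : ℕ), Measurable h → (∀ x, ‖h x‖ ≤ N) → (∀ x, (N : ℝ) < ‖x‖ → h x = 0) →
      ‖∫ x, h x * g x‖ ≤ K * (∫ x, ‖h x‖ ^ P) ^ (1 / P)) :
    ∫⁻ x, ‖g x‖ₑ ^ Q ≤ ENNReal.ofReal (K ^ Q) := by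
  have hQ0 := hc.symm.pos
  have hP0 := hc.pos
  set A : ℕ → Set V := fun N => {x | ‖x‖ ≤ N ∧ ‖g x‖ ≤ N} with hA
  have hAm : ∀ N, MeasurableSet (A N) := fun N =>
    (measurableSet_le measurable_norm measurable_const).inter
      (measurableSet_le hg.norm measurable_const)
  have hcov : AECover volume Filter.atTop A := by
    refine ⟨Filter.Eventually.of_forall fun x => ?_, hAm⟩
    filter_upwards [Filter.eventually_ge_atTop ⌈‖x‖⌉₊, Filter.eventually_ge_atTop ⌈‖g x‖⌉₊]
      with N h1 h2
    exact ⟨Nat.ceil_le.1 h1, Nat.ceil_le.1 h2⟩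
  refine le_of_tendsto' (hcov.lintegral_tendsto_of_countably_generated
    (hg.enorm.pow_const _).aemeasurable) fun N => ?_
  -- The extremal function for Hölder: on `A N` one has `u g = |u|^P = |g|^Q`. The hypothesis
  -- becomes `I ≤ K I^{1/P}`, and the truncation makes `I` finite, so that one may divide.
  set u : V → ℂ := (A N).indicator fun x => ((‖g x‖ ^ (Q - 2) : ℝ) : ℂ) * (starRingEnd ℂ) (g x)
    with hu
  have hum : Measurable u := by
    refine Measurable.indicator ?_ (hAm N)
    exact Measurable.mul (by fun_prop) (Complex.continuous_conj.measurable.comp hg)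
  have hun : ∀ x, ‖u x‖ = (A N).indicator (fun x => ‖g x‖ ^ (Q - 1)) x := by
    intro x
    by_cases hx : x ∈ A N
    · simp only [hu, Set.indicator_of_mem hx, norm_mul, RCLike.norm_conj, Complex.norm_real,
        Real.norm_eq_abs]
      rw [abs_of_nonneg (by positivity)]
      rcases (norm_nonneg (g x)).eq_or_lt with h0 | h0
      · rw [← h0, mul_zero, Real.zero_rpow (by linarith)]
      · nth_rw 2 [← Real.rpow_one ‖g x‖]
        rw [← Real.rpow_add h0]
        ring_nf
    · simp [hu, hx]
  obtain ⟨N', hN'⟩ : ∃ N' : ℕ, (N : ℝ) ^ (Q - 1) ≤ N' ∧ (N : ℝ) ≤ N' :=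
    ⟨max ⌈(N : ℝ) ^ (Q - 1)⌉₊ N, by
      push_cast; exact (Nat.le_ceil _).trans (le_max_left _ _), by push_cast; exact le_max_right _ _⟩
  have key := h u N' hum (fun x => by
      rw [hun]
      by_cases hx : x ∈ A N
      · rw [Set.indicator_of_mem hx]
        exact (Real.rpow_le_rpow (norm_nonneg _) hx.2 (by linarith)).trans hN'.1
      · rw [Set.indicator_of_notMem hx]; positivity) (fun x hx => by
      refine Set.indicator_of_notMem (fun hxA => ?_) _
      exact absurd (hxA.1.trans hN'.2) (not_le.2 hx))
  set I : ℝ := ∫ x in A N, ‖g x‖ ^ Q with hI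
  have hI0 : 0 ≤ I := integral_nonneg fun x => by positivity
  have e1 : ∫ x, u x * g x = (I : ℂ) := by
    rw [hI, ← integral_indicator (hAm N), ← integral_complex_ofReal]
    refine integral_congr_ae (Filter.Eventually.of_forall fun x => ?_)
    by_cases hx : x ∈ A N
    · simp only [hu, Set.indicator_of_mem hx]
      rw [mul_assoc, mul_comm (starRingEnd ℂ (g x)), Complex.mul_conj, Complex.normSq_eq_norm_sq,
        ← Complex.ofReal_mul]
      congr 1
      rcases (norm_nonneg (g x)).eq_or_lt with h0 | h0
      · rw [← h0, Real.zero_rpow hQ0.ne']; simp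
      · rw [← Real.rpow_two, ← Real.rpow_add h0]
        ring_nf
    · simp [hu, hx]
  have e2 : ∫ x, ‖u x‖ ^ P = I := by
    rw [hI, ← integral_indicator (hAm N)]
    refine integral_congr_ae (Filter.Eventually.of_forall fun x => ?_)
    simp only [hun]
    by_cases hx : x ∈ A N
    · simp only [Set.indicator_of_mem hx]
      rw [← Real.rpow_mul (norm_nonneg _), hc.symm.sub_one_mul_conj]
    · simp [hx, hP0.ne']
  have hIint : IntegrableOn (fun x => ‖g x‖ ^ Q) (A N) := by
    have hfin : volume (A N) < ∞ := by
      refine (measure_mono ?_).trans_lt (measure_closedBall_lt_top (x := (0 : V)) (r := N))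
      intro x hx
      simpa using hx.1
    refine Measure.integrableOn_of_bounded (M := (N : ℝ) ^ Q) hfin.ne
      (hg.norm.pow_const _).aestronglyMeasurable ?_
    filter_upwards [ae_restrict_mem (hAm N)] with x hx
    rw [Real.norm_of_nonneg (by positivity)]
    exact Real.rpow_le_rpow (norm_nonneg _) hx.2 hQ0.le
  have e3 : ∫⁻ x in A N, ‖g x‖ₑ ^ Q = ENNReal.ofReal I := by
    rw [hI, ofReal_integral_eq_lintegral_ofReal hIint
      (Filter.Eventually.of_forall fun x => by positivity)]
    simp_rw [← ofReal_norm, ENNReal.ofReal_rpow_of_nonneg (norm_nonneg _) hQ0.le]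
  rw [e3]
  refine ENNReal.ofReal_le_ofReal ?_
  rw [e1, e2, Complex.norm_real, Real.norm_of_nonneg hI0] at key
  rcases hI0.eq_or_lt with h0 | h0
  · rw [← h0]; positivity
  · have h5 : I ^ (1 / Q) ≤ K := by
      have h6 : I ^ (1 / Q) * I ^ (1 / P) = I := by
        rw [← Real.rpow_add h0, one_div, one_div, add_comm, hc.inv_add_inv_eq_one, Real.rpow_one]
      rw [← h6] at key
      exact le_of_mul_le_mul_right (by rwa [h6] at key ⊢) (by positivity)
    calc I = (I ^ (1 / Q)) ^ Q := by
          rw [← Real.rpow_mul hI0, one_div, inv_mul_cancel₀ hQ0.ne', Real.rpow_one]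
      _ ≤ K ^ Q := Real.rpow_le_rpow (by positivity) h5 hQ0.le

/-- The dual of `L^p` for `1 < p ≤ 2`, tested against Schwartz functions. -/
theorem exists_Lp_repr_of_functional {p q : ℝ≥0∞} [Fact (1 ≤ p)] [Fact (1 ≤ q)]
    (hpq : p.HolderConjugate q) (hp : 1 < p) (hp2 : p ≤ 2)
    (Λ : Lp ℂ p (volume : Measure V) →L[ℂ] ℂ) :
    ∃ g : Lp ℂ q (volume : Measure V), ‖g‖ ≤ ‖Λ‖ ∧
      ∀ φ : 𝓢(V, ℂ), Λ (φ.toLp p) = ∫ x, φ x * g x := by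
  obtain ⟨hc, hP1, hP2, hQ2, hptop, hqtop⟩ := holderConjugate_toReal_of_one_lt hpq hp hp2
  obtain ⟨k, g, hgm, hg⟩ := exists_integral_repr_of_rapid_decay hp2 Λ
  have hbound : ∫⁻ x, ‖g x‖ₑ ^ q.toReal ≤ ENNReal.ofReal (‖Λ‖ ^ q.toReal) := by
    refine lintegral_rpow_le_of_integral_mul_le hc hQ2 hgm (norm_nonneg _) fun h N hm hb hs => ?_
    have hbd : ∀ (u : V → ℂ) (M : ℝ) (r : ℝ≥0∞), Measurable u → (∀ x, ‖x‖ ≤ N → ‖u x‖ ≤ M) →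
        (∀ x, (N : ℝ) < ‖x‖ → u x = 0) → MemLp u r volume := by
      intro u M r hum hub hus
      have : u = (Metric.closedBall (0 : V) N).indicator u := by
        ext x
        by_cases hx : ‖x‖ ≤ N
        · rw [Set.indicator_of_mem (by simpa using hx)]
        · rw [Set.indicator_of_notMem (by simpa using hx), hus x (not_le.1 hx)]
      rw [this, memLp_indicator_iff_restrict Metric.isClosed_closedBall.measurableSet]
      have : IsFiniteMeasure ((volume : Measure V).restrict (Metric.closedBall (0 : V) N)) :=
        ⟨by simpa using measure_closedBall_lt_top⟩
      refine MemLp.of_bound hum.aestronglyMeasurable M ?_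
      filter_upwards [ae_restrict_mem Metric.isClosed_closedBall.measurableSet] with x hx
      exact hub x (by simpa using hx)
    have hh : MemLp h p volume := hbd h N p hm (fun x _ => hb x) hs
    have hk2 : MemLp (fun x => ((1 + ‖x‖ : ℝ) : ℂ) ^ k * h x) 2 volume := by
      refine hbd _ ((1 + N) ^ k * N) 2 (by fun_prop) (fun x hx => ?_)
        fun x hx => by rw [hs x hx, mul_zero]
      rw [norm_mul, norm_pow, Complex.norm_real, Real.norm_of_nonneg (by positivity)]
      gcongr
      exact hb x
    rw [← hg h hh hk2]
    refine (Λ.le_opNorm _).trans ?_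
    gcongr
    rw [Lp.norm_toLp, hh.eLpNorm_eq_integral_rpow_norm hpq.ne_zero hptop,
      ENNReal.toReal_ofReal (by positivity), one_div]
  have hgmem : MemLp g q volume := by
    refine ⟨hgm.aestronglyMeasurable, ?_⟩
    rw [eLpNorm_lt_top_iff_lintegral_rpow_enorm_lt_top hpq.symm.ne_zero hqtop]
    exact hbound.trans_lt ENNReal.ofReal_lt_top
  refine ⟨hgmem.toLp, ?_, fun φ => ?_⟩
  · rw [Lp.norm_toLp]
    refine ENNReal.toReal_le_of_le_ofReal (norm_nonneg _) ?_
    rw [eLpNorm_eq_lintegral_rpow_enorm_toReal hpq.symm.ne_zero hqtop]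
    have hQ0 := hc.symm.pos
    calc (∫⁻ x, ‖g x‖ₑ ^ q.toReal) ^ (1 / q.toReal)
        ≤ (ENNReal.ofReal (‖Λ‖ ^ q.toReal)) ^ (1 / q.toReal) :=
          ENNReal.rpow_le_rpow hbound (by positivity)
      _ = ENNReal.ofReal ‖Λ‖ := by
          rw [ENNReal.ofReal_rpow_of_nonneg (by positivity) (by positivity),
            ← Real.rpow_mul (norm_nonneg _), mul_one_div_cancel hQ0.ne', Real.rpow_one]
  -- Schwartz functions decay fast enough for the representation, by `(1+|x|)^k ≤ 2^k (1+|x|²)^k`.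
  · have hφ : MemLp (fun x => ((1 + ‖x‖ : ℝ) : ℂ) ^ k * φ x) 2 volume := by
      have hgr : (fun x : V => (((1 + ‖x‖ ^ 2) ^ (k : ℝ) : ℝ) : ℂ)).HasTemperateGrowth := by fun_prop
      refine (((SchwartzMap.smulLeftCLM ℂ (fun x : V => (((1 + ‖x‖ ^ 2) ^ (k : ℝ) : ℝ) : ℂ)) φ).memLp
        2 volume).const_mul ((2 : ℂ) ^ k)).mono ?_ (Filter.Eventually.of_forall fun x => ?_)
      · exact Continuous.aestronglyMeasurable (by have := φ.continuous; fun_prop)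
      · rw [SchwartzMap.smulLeftCLM_apply_apply hgr, smul_eq_mul, ← mul_assoc, norm_mul, norm_mul]
        gcongr
        rw [norm_mul, norm_pow, norm_pow, Complex.norm_real, Complex.norm_real,
          Real.norm_of_nonneg (by positivity), Real.norm_of_nonneg (by positivity),
          Real.rpow_natCast, Complex.norm_ofNat, ← mul_pow]
        gcongr
        nlinarith [sq_nonneg (‖x‖ - 1), sq_nonneg ‖x‖]
    rw [SchwartzMap.toLp, hg φ (φ.memLp p volume) hφ]
    refine integral_congr_ae ?_
    filter_upwards [hgmem.coeFn_toLp] with x hx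
    rw [hx]

end Duality

/-! ### Polar coordinates on the cylinder and the Fourier slice theorem -/

section Geometry

variable {n : ℕ}

instance : IsFiniteMeasure (sphereMeasure n) := by unfold sphereMeasure; infer_instance

instance : SFinite (cylinderMeasure n) := by unfold cylinderMeasure; infer_instance

instance : SigmaFinite (cylinderMeasure n) := by unfold cylinderMeasure; infer_instance

/-- Integration in polar coordinates. -/
theorem lintegral_eq_lintegral_polar (hn : 1 ≤ n) {F : E n → ℝ≥0∞} (hF : Measurable F) :
    ∫⁻ ξ, F ξ = ∫⁻ r in Set.Ioi (0 : ℝ),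
      ENNReal.ofReal (r ^ (n - 1)) * ∫⁻ θ, F (r • (θ : E n)) ∂(sphereMeasure n) := by
  have hd : Module.finrank ℝ (E n) = n := by simp
  have : Nontrivial (E n) := Module.nontrivial_of_finrank_pos (R := ℝ) (by rw [hd]; omega)
  have hmp := (volume : Measure (E n)).measurePreserving_homeomorphUnitSphereProd
  have h1 : ∫⁻ ξ, F ξ = ∫⁻ ξ : ({0}ᶜ : Set (E n)), F ξ ∂(Measure.comap Subtype.val volume) := by
    rw [lintegral_subtype_comap (measurableSet_singleton _).compl, restrict_compl_singleton]
  have h2 : ∫⁻ ξ : ({0}ᶜ : Set (E n)), F ξ ∂(Measure.comap Subtype.val volume) =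
      ∫⁻ z, F ((z.2 : ℝ) • (z.1 : E n))
        ∂((sphereMeasure n).prod (Measure.volumeIoiPow (Module.finrank ℝ (E n) - 1))) := by
    unfold sphereMeasure
    rw [← hmp.lintegral_comp_emb (Homeomorph.measurableEmbedding _)]
    refine lintegral_congr fun ξ => ?_
    have hξ : ‖(ξ : E n)‖ ≠ 0 := norm_ne_zero_iff.2 ξ.2
    congr 1
    simp [smul_smul, hξ]
  have hFm : Measurable fun z : Sph n × Set.Ioi (0 : ℝ) => F ((z.2 : ℝ) • (z.1 : E n)) := by
    fun_prop
  rw [h1, h2, lintegral_prod_symm' _ hFm, Measure.volumeIoiPow,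
    lintegral_withDensity_eq_lintegral_mul _ (by fun_prop) (by
      exact Measurable.lintegral_prod_left' hFm)]
  simp only [Pi.mul_apply]
  rw [lintegral_subtype_comap measurableSet_Ioi (fun r : ℝ => ENNReal.ofReal
    (r ^ (Module.finrank ℝ (E n) - 1)) * ∫⁻ θ, F (r • (θ : E n)) ∂(sphereMeasure n)), hd]

/-- The map `(τ, θ) ↦ τ θ` from the cylinder to `ℝⁿ`. -/
def polarMap (z : ℝ × Sph n) : E n := z.1 • (z.2 : E n)

theorem continuous_polarMap : Continuous (polarMap (n := n)) := by
  unfold polarMap; fun_prop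

/-- The factor `2` arises because `(τ, θ)` and `(-τ, -θ)` have the same image; the half-cylinders `τ
> 0` and `τ < 0` contribute equally. The power of `|ξ|` cancels the Jacobian `r^{n-1}` of polar
coordinates. -/
theorem lintegral_cylinder_comp_polarMap (hn : 1 ≤ n) {F : E n → ℝ≥0∞} (hF : Measurable F) :
    ∫⁻ z, F (polarMap z) ∂(cylinderMeasure n) =
      2 * ∫⁻ ξ, F ξ * ENNReal.ofReal (‖ξ‖ ^ (-((n : ℝ) - 1))) := by
  have hpos : ∀ G : E n → ℝ≥0∞, Measurable G →
      ∫⁻ r in Set.Ioi (0 : ℝ), ∫⁻ θ, G (r • (θ : E n)) ∂(sphereMeasure n) =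
      ∫⁻ ξ, G ξ * ENNReal.ofReal (‖ξ‖ ^ (-((n : ℝ) - 1))) := by
    intro G hG
    rw [lintegral_eq_lintegral_polar hn (by fun_prop)]
    refine setLIntegral_congr_fun measurableSet_Ioi fun r (hr : 0 < r) => ?_
    have h1 : ∀ θ : Sph n, ‖r • (θ : E n)‖ = r := fun θ => by simp [norm_smul, hr.le]
    simp only [h1]
    rw [lintegral_mul_const' _ _ ENNReal.ofReal_ne_top, mul_left_comm,
      ← ENNReal.ofReal_mul (by positivity), ← Real.rpow_natCast, Nat.cast_sub hn, Nat.cast_one,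
      ← Real.rpow_add hr, add_neg_cancel, Real.rpow_zero, ENNReal.ofReal_one, mul_one]
  have hm : Measurable fun z : ℝ × Sph n => F (polarMap z) :=
    hF.comp continuous_polarMap.measurable
  rw [cylinderMeasure, lintegral_prod _ hm.aemeasurable]
  rw [← lintegral_add_compl _ (measurableSet_Ioi (a := (0 : ℝ))), two_mul, Set.compl_Ioi]
  congr 1
  · exact hpos F hF
  · rw [setLIntegral_congr Iio_ae_eq_Iic.symm]
    have h2 : ∫⁻ r in Set.Iio (0 : ℝ), ∫⁻ θ, F (r • (θ : E n)) ∂(sphereMeasure n) =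
        ∫⁻ r in Set.Ioi (0 : ℝ), ∫⁻ θ, F (-(r • (θ : E n))) ∂(sphereMeasure n) := by
      have := (Measure.measurePreserving_neg (volume : Measure ℝ)).setLIntegral_comp_preimage_emb
        (MeasurableEquiv.neg ℝ).measurableEmbedding
        (fun r => ∫⁻ θ, F (r • (θ : E n)) ∂(sphereMeasure n)) (Set.Iio 0)
      rw [← this]
      simp
    refine h2.trans ((hpos (fun ξ => F (-ξ)) (by fun_prop)).trans ?_)
    rw [← (Measure.measurePreserving_neg (volume : Measure (E n))).lintegral_comp_emb
      (MeasurableEquiv.neg (E n)).measurableEmbedding]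
    simp

/-- The push-forward of `dτ dθ` under `(τ, θ) ↦ τ θ`. -/
noncomputable def polarMeasure (n : ℕ) : Measure (E n) := (cylinderMeasure n).map polarMap

theorem measurePreserving_polarMap :
    MeasurePreserving (polarMap (n := n)) (cylinderMeasure n) (polarMeasure n) :=
  ⟨continuous_polarMap.measurable, rfl⟩

theorem lintegral_polarMeasure (hn : 1 ≤ n) {F : E n → ℝ≥0∞} (hF : Measurable F) :
    ∫⁻ ξ, F ξ ∂(polarMeasure n) = 2 * ∫⁻ ξ, F ξ * ENNReal.ofReal (‖ξ‖ ^ (-((n : ℝ) - 1))) := by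
  rw [polarMeasure, lintegral_map hF continuous_polarMap.measurable,
    lintegral_cylinder_comp_polarMap hn hF]

theorem polarMeasure_eq_withDensity (hn : 1 ≤ n) :
    polarMeasure n = (volume : Measure (E n)).withDensity
      fun ξ => 2 * ENNReal.ofReal (‖ξ‖ ^ (-((n : ℝ) - 1))) := by
  ext s hs
  rw [withDensity_apply _ hs, ← lintegral_indicator_one hs,
    lintegral_polarMeasure hn (measurable_one.indicator hs), ← lintegral_const_mul _ (by
      exact Measurable.mul (measurable_one.indicator hs) (by fun_prop)),
    ← lintegral_indicator hs]
  refine lintegral_congr fun ξ => ?_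
  by_cases h : ξ ∈ s <;> simp [h]

/-- The isometric parametrization of `ℝⁿ` by the hyperplanes orthogonal to `θ` preserves volume. -/
theorem measurePreserving_smul_add (θ : Sph n) :
    MeasurePreserving (fun z : ℝ × (Submodule.span ℝ {(θ : E n)})ᗮ =>
      z.1 • (θ : E n) + (z.2 : E n)) := by
  set K := Submodule.span ℝ {(θ : E n)} with hK
  have hθ : ‖(θ : E n)‖ = 1 := by simp
  have h1 : MeasurePreserving (LinearIsometryEquiv.toSpanUnitSingleton (𝕜 := ℝ) (θ : E n) hθ) :=
    LinearIsometryEquiv.measurePreserving _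
  have h2 := h1.prod (MeasurePreserving.id (volume : Measure Kᗮ))
  have h3 := (WithLp.volume_preserving_toLp K Kᗮ).comp h2
  have h4 := (K.orthogonalDecomposition.symm.measurePreserving).comp h3
  convert h4 using 1
  · ext z
    simp
  · rfl

/-- The Fourier slice theorem. -/
theorem fourier_radon {f : E n → ℂ} (hf : Integrable f) (θ : Sph n) (τ : ℝ) :
    𝓕 (fun σ => radon f σ θ) τ = 𝓕 f (τ • (θ : E n)) := by
  have hmp := measurePreserving_smul_add θ
  set g : E n → ℂ := fun x => Real.fourierChar (-(inner ℝ x (τ • (θ : E n)))) • f x with hg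
  have hgi : Integrable g := (Real.fourierIntegral_convergent_iff (τ • (θ : E n))).2 hf
  have hgc : Integrable (fun z : ℝ × (Submodule.span ℝ {(θ : E n)})ᗮ => g (z.1 • (θ : E n) + (z.2 : E n))) := by
    exact hmp.integrable_comp_of_integrable hgi
  have hint := integral_map (f := g) hmp.measurable.aemeasurable
    (by rw [hmp.map_eq]; exact hgi.aestronglyMeasurable)
  rw [hmp.map_eq] at hint
  rw [Real.fourier_eq, Real.fourier_eq, ← hg, hint]
  rw [Measure.volume_eq_prod, integral_prod _ (by exact hgc)]
  refine integral_congr_ae (Filter.Eventually.of_forall fun σ => ?_)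
  simp only [radon, Circle.smul_def, hg]
  rw [OrthonormalBasis.addHaar_eq_volume]
  rw [← integral_smul]
  refine integral_congr_ae (Filter.Eventually.of_forall fun y => ?_)
  -- On the hyperplane `x·θ = σ` the phase `x·τθ` is the constant `στ`, so Fubini along the
  -- hyperplanes gives the claim.
  have hy : inner ℝ (y : E n) (θ : E n) = 0 :=
    Submodule.inner_left_of_mem_orthogonal (Submodule.mem_span_singleton_self _) y.2
  simp [inner_add_left, inner_smul_left, inner_smul_right, hy]

/-- As `|τθ| = |τ|`, the weight also depends on `τθ` alone, so the whole weighted transform factors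
through `polarMap`. -/
theorem weightedFourier_radon {f : E n → ℂ} (hf : Integrable f) (s t : ℝ) :
    weightedFourier s t (radon f) = fun z => (vWeight s t (polarMap z) : ℂ) * 𝓕 f (polarMap z) := by
  ext z
  rw [weightedFourier, fourier_radon hf]
  simp [vWeight, polarMap, norm_smul]

theorem measurable_vWeight {V : Type*} [NormedAddCommGroup V] [MeasurableSpace V] [BorelSpace V]
    (s t : ℝ) : Measurable (vWeight s t : V → ℝ) := by
  unfold vWeight; fun_prop

theorem sinogramNorm_radon {f : E n → ℂ} (hf : Integrable f) (s t : ℝ) {p : ℝ≥0∞} (hp0 : p ≠ 0)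
    (hp : p ≠ ∞) : sinogramNorm s t p (radon f) =
      eLpNorm (fun ξ => (vWeight s t ξ : ℂ) * 𝓕 f ξ) p (polarMeasure n) := by
  have hm : Measurable fun ξ => (vWeight s t ξ : ℂ) * 𝓕 f ξ :=
    Measurable.mul (Complex.measurable_ofReal.comp (measurable_vWeight s t))
      (continuous_fourier_of_integrable hf).measurable
  have h0 : 0 < p.toReal := ENNReal.toReal_pos hp0 hp
  rw [← eLpNorm_comp_measurePreserving hm.aestronglyMeasurable measurePreserving_polarMap,
    eLpNorm_eq_lintegral_rpow_enorm_toReal hp0 hp, sinogramNorm, cylinderMeasure,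
    lintegral_prod_symm' _ (by
      have := (hm.comp continuous_polarMap.measurable).enorm.pow_const p.toReal
      exact this)]
  congr 1
  refine lintegral_congr fun θ => ?_
  rw [sNorm, eLpNorm_eq_lintegral_rpow_enorm_toReal hp0 hp, ← ENNReal.rpow_mul,
    one_div_mul_cancel h0.ne', ENNReal.rpow_one]
  refine lintegral_congr fun τ => ?_
  have := congrFun (weightedFourier_radon hf s t) (τ, θ)
  rw [weightedFourier] at this
  simp only at this
  rw [this]
  rfl

end Geometry

/-! ### Tensor products of Schwartz functions -/

section Tensor

variable {V W : Type*} [NormedAddCommGroup V] [NormedSpace ℝ V] [NormedAddCommGroup W]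
  [NormedSpace ℝ W]

theorem norm_iteratedFDeriv_comp_fst_le (f : 𝓢(V, ℂ)) (i : ℕ) (z : V × W) :
    ‖iteratedFDeriv ℝ i (fun z : V × W => f z.1) z‖ ≤ ‖iteratedFDeriv ℝ i f z.1‖ := by
  have := (ContinuousLinearMap.fst ℝ V W).iteratedFDeriv_comp_right (f.smooth i) z
    (i := i) le_rfl
  change ‖iteratedFDeriv ℝ i (f ∘ (ContinuousLinearMap.fst ℝ V W)) z‖ ≤ _
  rw [this]
  refine (ContinuousMultilinearMap.norm_compContinuousLinearMap_le _ _).trans ?_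
  refine mul_le_of_le_one_right (norm_nonneg _) ?_
  exact Finset.prod_le_one (fun _ _ => norm_nonneg _) fun _ _ => ContinuousLinearMap.norm_fst_le _ _ _

theorem norm_iteratedFDeriv_comp_snd_le (f : 𝓢(W, ℂ)) (i : ℕ) (z : V × W) :
    ‖iteratedFDeriv ℝ i (fun z : V × W => f z.2) z‖ ≤ ‖iteratedFDeriv ℝ i f z.2‖ := by
  have := (ContinuousLinearMap.snd ℝ V W).iteratedFDeriv_comp_right (f.smooth i) z
    (i := i) le_rfl
  change ‖iteratedFDeriv ℝ i (f ∘ (ContinuousLinearMap.snd ℝ V W)) z‖ ≤ _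
  rw [this]
  refine (ContinuousMultilinearMap.norm_compContinuousLinearMap_le _ _).trans ?_
  refine mul_le_of_le_one_right (norm_nonneg _) ?_
  exact Finset.prod_le_one (fun _ _ => norm_nonneg _) fun _ _ => ContinuousLinearMap.norm_snd_le _ _ _

/-- The tensor product of two Schwartz functions. -/
noncomputable def schwartzTensor (f : 𝓢(V, ℂ)) (g : 𝓢(W, ℂ)) : 𝓢(V × W, ℂ) where
  toFun z := f z.1 * g z.2
  smooth' := ((f.smooth _).comp contDiff_fst).mul ((g.smooth _).comp contDiff_snd)
  decay' k m := by
    choose Cf hCf using f.decay'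
    choose Cg hCg using g.decay'
    -- The bound comes from the Leibniz rule together with `‖z‖^k ≤ ‖z.1‖^k + ‖z.2‖^k` for the
    -- maximum norm on the product.
    refine ⟨∑ i ∈ Finset.range (m + 1), (m.choose i : ℝ) *
      (Cf k i * Cg 0 (m - i) + Cf 0 i * Cg k (m - i)), fun z => ?_⟩
    have h1 := norm_iteratedFDeriv_mul_le (𝕜 := ℝ) (N := (m : ℕ∞))
      (f := fun z : V × W => f z.1) (g := fun z : V × W => g z.2)
      ((f.smooth m).comp contDiff_fst) ((g.smooth m).comp contDiff_snd) z (n := m) le_rfl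
    refine (mul_le_mul_of_nonneg_left h1 (by positivity)).trans ?_
    rw [Finset.mul_sum]
    refine Finset.sum_le_sum fun i _ => ?_
    rw [mul_assoc, mul_left_comm]
    refine mul_le_mul_of_nonneg_left ?_ (by positivity)
    set a := ‖iteratedFDeriv ℝ i f z.1‖
    set b := ‖iteratedFDeriv ℝ (m - i) g z.2‖
    have h2 : ‖z‖ ^ k ≤ ‖z.1‖ ^ k + ‖z.2‖ ^ k := by
      rcases le_total ‖z.1‖ ‖z.2‖ with h | h
      · rw [Prod.norm_def, max_eq_right h]
        exact le_add_of_nonneg_left (by positivity)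
      · rw [Prod.norm_def, max_eq_left h]
        exact le_add_of_nonneg_right (by positivity)
    calc ‖z‖ ^ k * (‖iteratedFDeriv ℝ i (fun z : V × W => f z.1) z‖ *
          ‖iteratedFDeriv ℝ (m - i) (fun z : V × W => g z.2) z‖)
        ≤ (‖z.1‖ ^ k + ‖z.2‖ ^ k) * (a * b) := by
          gcongr
          · exact norm_iteratedFDeriv_comp_fst_le f i z
          · exact norm_iteratedFDeriv_comp_snd_le g (m - i) z
      _ = (‖z.1‖ ^ k * a) * (‖z.2‖ ^ 0 * b) + (‖z.1‖ ^ 0 * a) * (‖z.2‖ ^ k * b) := by ring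
      _ ≤ _ := by
          have hz : ∀ k i, 0 ≤ Cf k i := fun k i => le_trans (by positivity) (hCf k i 0)
          refine add_le_add ?_ ?_
          · exact mul_le_mul (hCf k i z.1) (hCg 0 (m - i) z.2) (by positivity) (hz _ _)
          · exact mul_le_mul (hCf 0 i z.1) (hCg k (m - i) z.2) (by positivity) (hz _ _)

end Tensor

/-! ### Rectangles span a dense subspace of `L^p` of a product -/

section ProductDensity

variable {X Y : Type*} [MeasurableSpace X] [MeasurableSpace Y] {μ : Measure X} {ν : Measure Y}

theorem eLpNorm_prod_mul [SFinite ν] {p : ℝ≥0∞} (hp0 : p ≠ 0) (hp : p ≠ ∞) {f : X → ℂ} {g : Y → ℂ}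
    (hf : AEStronglyMeasurable f μ) (hg : AEStronglyMeasurable g ν) :
    eLpNorm (fun z : X × Y => f z.1 * g z.2) p (μ.prod ν) = eLpNorm f p μ * eLpNorm g p ν := by
  have h0 : 0 < p.toReal := ENNReal.toReal_pos hp0 hp
  simp_rw [eLpNorm_eq_lintegral_rpow_enorm_toReal hp0 hp, enorm_mul,
    ENNReal.mul_rpow_of_nonneg _ _ h0.le]
  rw [lintegral_prod_mul (hf.enorm.pow_const _) (hg.enorm.pow_const _),
    ENNReal.mul_rpow_of_nonneg _ _ (by positivity)]

/-- The measure of `s \ t i` tends to `0` by continuity from above, which for `p < ∞` is convergence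
of the indicators in `L^p`. -/
theorem indicatorConstLp_mem_of_monotone {α : Type*} [MeasurableSpace α] {m : Measure α}
    {p : ℝ≥0∞} [Fact (1 ≤ p)] (hp : p ≠ ∞) {W : Set (Lp ℂ p m)} (hW : IsClosed W)
    {t : ℕ → Set α} {s : Set α} (hs : MeasurableSet s) (hμs : m s ≠ ∞)
    (ht : ∀ i, MeasurableSet (t i)) (hμt : ∀ i, m (t i) ≠ ∞) (hmono : Monotone t)
    (hts : ⋃ i, t i = s) (h : ∀ i, indicatorConstLp p (ht i) (hμt i) (1 : ℂ) ∈ W) :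
    indicatorConstLp p hs hμs (1 : ℂ) ∈ W := by
  refine hW.mem_of_tendsto (b := Filter.atTop) (tendsto_indicatorConstLp_set hp ?_) (Filter.Eventually.of_forall h)
  have h1 : ∀ i, symmDiff (t i) s = s \ t i := fun i => by
    have : t i ⊆ s := hts ▸ Set.subset_iUnion t i
    rw [Set.symmDiff_def, Set.sdiff_eq_empty.2 this, Set.empty_union]
  simp_rw [h1]
  have h2 := tendsto_measure_iInter_atTop (μ := m) (s := fun i => s \ t i)
    (fun i => (hs.diff (ht i)).nullMeasurableSet)
    (fun i j hij => Set.sdiff_subset_sdiff_right (hmono hij))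
    ⟨0, ((measure_mono Set.sdiff_subset).trans_lt hμs.lt_top).ne⟩
  rwa [← Set.sdiff_iUnion, hts, Set.sdiff_self, measure_empty] at h2

/-- A closed subspace of `L^p(μ × ν)` that contains the indicators of all rectangles of finite
measure is everything. -/
theorem eq_top_of_indicator_prod_mem [SigmaFinite μ] [IsFiniteMeasure ν] {p : ℝ≥0∞}
    [Fact (1 ≤ p)] (hp : p ≠ ∞) {m : Measure (X × Y)} (hm : m = μ.prod ν) {W : Submodule ℂ (Lp ℂ p m)}
    (hW : IsClosed (W : Set (Lp ℂ p m)))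
    (h : ∀ (A : Set X) (B : Set Y) (hA : MeasurableSet A) (hB : MeasurableSet B)
      (_ : μ A ≠ ∞) (hAB : m (A ×ˢ B) ≠ ∞), indicatorConstLp p (hA.prod hB) hAB (1 : ℂ) ∈ W) :
    W = ⊤ := by
  subst hm
  have hfin : ∀ (N : ℕ) (s : Set (X × Y)),
      μ.prod ν (s ∩ spanningSets μ N ×ˢ Set.univ) ≠ ∞ := fun N s => by
    refine ((measure_mono Set.inter_subset_right).trans_lt ?_).ne
    rw [Measure.prod_prod]
    exact ENNReal.mul_lt_top (measure_spanningSets_lt_top μ N) (measure_lt_top ν _)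
  have hDm : ∀ N : ℕ, MeasurableSet (spanningSets μ N ×ˢ (Set.univ : Set Y)) := fun N =>
    (measurableSet_spanningSets μ N).prod MeasurableSet.univ
  -- A π-λ argument starting from rectangles. It is carried out inside sets of finite measure, so
  -- that complements still have indicators in `L^p`; the cutoff is removed by monotone limits in
  -- `hall`.
  have hrect : ∀ (N : ℕ) (s : Set (X × Y)) (hs : MeasurableSet s),
      indicatorConstLp p (hs.inter (hDm N)) (hfin N s) (1 : ℂ) ∈ W := by
    intro N s hs
    induction s, hs using MeasurableSpace.induction_on_inter (s := Set.image2 (· ×ˢ ·)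
      {A : Set X | MeasurableSet A} {B : Set Y | MeasurableSet B}) generateFrom_prod.symm
      isPiSystem_prod with
    | empty =>
      convert W.zero_mem using 1
      simp
    | basic s hs =>
      obtain ⟨A, hA, B, hB, rfl⟩ := hs
      have e : (A ×ˢ B) ∩ spanningSets μ N ×ˢ Set.univ = (A ∩ spanningSets μ N) ×ˢ B := by
        rw [Set.prod_inter_prod, Set.inter_univ]
      have := h (A ∩ spanningSets μ N) B (hA.inter (measurableSet_spanningSets μ N)) hB
        ((measure_mono Set.inter_subset_right).trans_lt (measure_spanningSets_lt_top μ N)).ne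
        (by rw [← e]; exact hfin N _)
      convert this using 2
    | compl s hs ih =>
      have h1 := h (spanningSets μ N) Set.univ (measurableSet_spanningSets μ N) MeasurableSet.univ
        (measure_spanningSets_lt_top μ N).ne (by simpa using hfin N Set.univ)
      convert W.sub_mem h1 ih using 1
      refine Lp.ext ?_
      filter_upwards [indicatorConstLp_coeFn (p := p) (hs := hs.compl.inter (hDm N))
        (hμs := hfin N sᶜ) (c := (1 : ℂ)), indicatorConstLp_coeFn (p := p) (hs := hDm N)
        (hμs := by simpa using hfin N Set.univ) (c := (1 : ℂ)),
        indicatorConstLp_coeFn (p := p) (hs := hs.inter (hDm N)) (hμs := hfin N s) (c := (1 : ℂ)),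
        Lp.coeFn_sub (indicatorConstLp p (hDm N) (by simpa using hfin N Set.univ) (1 : ℂ))
          (indicatorConstLp p (hs.inter (hDm N)) (hfin N s) (1 : ℂ))] with z h1 h2 h3 h4
      rw [h1, h4, Pi.sub_apply, h2, h3]
      by_cases hz : z ∈ spanningSets μ N ×ˢ (Set.univ : Set Y) <;> by_cases hz' : z ∈ s <;>
        simp only [Set.indicator, Set.mem_inter_iff, Set.mem_compl_iff, hz, hz'] <;> simp
    | iUnion f hd hm ih =>
      set t : ℕ → Set (X × Y) := fun i =>
        (⋃ j ∈ Finset.range i, f j) ∩ spanningSets μ N ×ˢ Set.univ with ht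
      have htm : ∀ i, MeasurableSet (⋃ j ∈ Finset.range i, f j) := fun i =>
        Finset.measurableSet_biUnion _ fun j _ => hm j
      refine indicatorConstLp_mem_of_monotone hp hW (t := t) _ _
        (fun i => (htm i).inter (hDm N)) (fun i => hfin N _) ?_ ?_ fun i => ?_
      · intro i j hij
        refine Set.inter_subset_inter_left _ (Set.biUnion_subset_biUnion_left fun k hk => ?_)
        exact Finset.range_mono hij hk
      · rw [ht, ← Set.iUnion_inter]
        congr 1
        ext z
        simp only [Set.mem_iUnion, Finset.mem_range]
        exact ⟨fun ⟨_, j, _, hj⟩ => ⟨j, hj⟩, fun ⟨j, hj⟩ => ⟨j + 1, j, Nat.lt_succ_self j, hj⟩⟩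
      · induction i with
        | zero =>
          convert W.zero_mem using 1
          simp [t]
        | succ i ihi =>
          have hdisj : Disjoint (t i) (f i ∩ spanningSets μ N ×ˢ Set.univ) := by
            refine Disjoint.mono Set.inter_subset_left Set.inter_subset_left ?_
            rw [Set.disjoint_iUnion₂_left]
            intro j hj
            exact hd (Finset.mem_range.1 hj).ne
          have hun : t (i + 1) = t i ∪ (f i ∩ spanningSets μ N ×ˢ Set.univ) := by
            simp only [t, Finset.range_add_one, Finset.set_biUnion_insert, Set.union_inter_distrib_right]
            rw [Set.union_comm]
          have := indicatorConstLp_disjoint_union (p := p) ((htm i).inter (hDm N))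
            ((hm i).inter (hDm N)) (hfin N _) (hfin N _) hdisj (1 : ℂ)
          have h3 := W.add_mem ihi (ih i)
          rw [← this] at h3
          change _ ∈ W
          convert h3 using 2
  have hall : ∀ (s : Set (X × Y)) (hs : MeasurableSet s) (hμs : μ.prod ν s ≠ ∞),
      indicatorConstLp p hs hμs (1 : ℂ) ∈ W := by
    intro s hs hμs
    refine indicatorConstLp_mem_of_monotone hp hW hs hμs (fun N => hs.inter (hDm N))
      (fun N => hfin N s) ?_ ?_ fun N => hrect N s hs
    · intro i j hij
      exact Set.inter_subset_inter_right _ (Set.prod_mono (monotone_spanningSets μ hij) subset_rfl)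
    · rw [← Set.inter_iUnion, ← Set.iUnion_prod_const, iUnion_spanningSets, Set.univ_prod_univ,
        Set.inter_univ]
  rw [eq_top_iff]
  rintro f -
  refine Lp.induction hp (motive := fun f => f ∈ W) (fun c s hs hμs => ?_)
    (fun f g hf hg _ h1 h2 => W.add_mem h1 h2) hW f
  have h1 := W.smul_mem c (hall s hs hμs.ne)
  rw [Lp.simpleFunc.coe_indicatorConst]
  convert h1 using 1
  refine Lp.ext ?_
  filter_upwards [indicatorConstLp_coeFn (p := p) (hs := hs) (hμs := hμs.ne) (c := c),
    indicatorConstLp_coeFn (p := p) (hs := hs) (hμs := hμs.ne) (c := (1 : ℂ)),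
    Lp.coeFn_smul c (indicatorConstLp p hs hμs.ne (1 : ℂ))] with z h1 h2 h3
  rw [h1, h3, Pi.smul_apply, h2]
  by_cases hz : z ∈ s <;> simp [hz]

end ProductDensity

/-! ### The sinogram space is all of `L^p` of the cylinder -/

section SinogramDensity

/-- Only the origin matters, and there `t ≥ 0` excludes a singularity. -/
theorem continuous_vWeight {V : Type*} [NormedAddCommGroup V] (s : ℝ) {t : ℝ} (ht : 0 ≤ t) :
    Continuous (vWeight s t : V → ℝ) := by
  unfold vWeight
  refine Continuous.mul ?_ ?_
  · exact Continuous.rpow_const (by fun_prop) fun x => Or.inl (by positivity)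
  · refine Continuous.rpow_const (Continuous.div (by fun_prop) ?_ fun x => ?_) fun x => Or.inr ht
    · exact Continuous.rpow_const (by fun_prop) fun x => Or.inl (by positivity)
    · positivity

theorem vWeight_pos {V : Type*} [NormedAddCommGroup V] (s t : ℝ) {x : V} (hx : x ≠ 0) :
    0 < vWeight s t x := by
  have := norm_pos_iff.2 hx
  unfold vWeight; positivity

theorem vWeight_nonneg {V : Type*} [NormedAddCommGroup V] (s t : ℝ) (x : V) :
    0 ≤ vWeight s t x := by
  unfold vWeight; positivity

/-- Products of a smooth compactly supported function with a continuous weight are dense in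
`L^p`. -/
theorem exists_eLpNorm_sub_mul_le {w : ℝ → ℝ} (hw : Continuous w) (hw0 : ∀ x, 0 ≤ w x)
    (hw1 : ∀ᵐ x, w x ≠ 0) {p : ℝ≥0∞} (hp1 : 1 ≤ p) (hp : p ≠ ∞) {f : ℝ → ℂ} (hfm : Measurable f)
    (hf : MemLp f p volume) {ε : ℝ} (hε : 0 < ε) :
    ∃ φ : ℝ → ℂ, HasCompactSupport φ ∧ ContDiff ℝ (⊤ : ℕ∞) φ ∧
      eLpNorm (fun x => f x - (w x : ℂ) * φ x) p volume ≤ ENNReal.ofReal ε := by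
  have hp0 : p ≠ 0 := (zero_lt_one.trans_le hp1).ne'
  have h0 : 0 < p.toReal := ENNReal.toReal_pos hp0 hp
  -- Multiplication by `w` is an isometry from `L^p(w^p dx)` to `L^p(dx)`. Since `w^p dx` is locally
  -- finite, `f/w` can be approximated there by test functions.
  set ρ : Measure ℝ := volume.withDensity fun x => ENNReal.ofReal (w x ^ p.toReal) with hρ
  have hwc : Continuous fun x => w x ^ p.toReal := hw.rpow_const fun x => Or.inr h0.le
  have : IsLocallyFiniteMeasure ρ := IsLocallyFiniteMeasure.withDensity_ofReal hwc
  have key : ∀ h : ℝ → ℂ, Measurable h →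
      eLpNorm h p ρ = eLpNorm (fun x => (w x : ℂ) * h x) p volume := by
    intro h hm
    rw [eLpNorm_eq_lintegral_rpow_enorm_toReal hp0 hp,
      eLpNorm_eq_lintegral_rpow_enorm_toReal hp0 hp, hρ,
      lintegral_withDensity_eq_lintegral_mul _ hwc.measurable.ennreal_ofReal
        (hm.enorm.pow_const _)]
    congr 1
    refine lintegral_congr fun x => ?_
    rw [Pi.mul_apply, enorm_mul, ENNReal.mul_rpow_of_nonneg _ _ h0.le,
      ← ofReal_norm (w x : ℂ), Complex.norm_real, Real.norm_of_nonneg (hw0 x),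
      ENNReal.ofReal_rpow_of_nonneg (hw0 x) h0.le]
  have hgm : Measurable fun x => f x / (w x : ℂ) := hfm.div (by fun_prop)
  have hae : (fun x => (w x : ℂ) * (f x / (w x : ℂ))) =ᵐ[volume] f := by
    filter_upwards [hw1] with x hx
    rw [mul_div_cancel₀]
    exact_mod_cast hx
  have hg : MemLp (fun x => f x / (w x : ℂ)) p ρ := by
    refine ⟨hgm.aestronglyMeasurable, ?_⟩
    rw [key _ hgm, eLpNorm_congr_ae hae]
    exact hf.2
  obtain ⟨φ, hφc, hφs, hφ⟩ := hg.exist_eLpNorm_sub_le hp hp1 hε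
  refine ⟨φ, hφc, hφs, ?_⟩
  rw [key _ (hgm.sub hφs.continuous.measurable)] at hφ
  refine le_trans (le_of_eq (eLpNorm_congr_ae ?_)) hφ
  filter_upwards [hae] with x hx
  rw [Pi.sub_apply, mul_sub, hx]

variable {n : ℕ}

/-- The sphere measure is pushed forward to `ℝⁿ`, so that the approximants are restrictions of
ambient test functions, as `IsSchwartzSinogram` demands. -/
theorem exists_eLpNorm_sphere_indicator_sub_le {B : Set (Sph n)} (hB : MeasurableSet B)
    {p : ℝ≥0∞} (hp1 : 1 ≤ p) (hp : p ≠ ∞) {ε : ℝ} (hε : 0 < ε) :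
    ∃ b : E n → ℂ, HasCompactSupport b ∧ ContDiff ℝ (⊤ : ℕ∞) b ∧
      eLpNorm (fun θ : Sph n => B.indicator (fun _ => (1 : ℂ)) θ - b θ) p (sphereMeasure n) ≤
        ENNReal.ofReal ε := by
  have hemb : MeasurableEmbedding (Subtype.val : Sph n → E n) :=
    MeasurableEmbedding.subtype_coe Metric.isClosed_sphere.measurableSet
  have hmp : MeasurePreserving (Subtype.val : Sph n → E n) (sphereMeasure n)
    ((sphereMeasure n).map Subtype.val) := ⟨hemb.measurable, rfl⟩
  have : IsFiniteMeasure ((sphereMeasure n).map (Subtype.val : Sph n → E n)) :=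
    Measure.isFiniteMeasure_map _ _
  have hB' : MeasurableSet ((Subtype.val : Sph n → E n) '' B) := hemb.measurableSet_image.2 hB
  have hf : MemLp (((Subtype.val : Sph n → E n) '' B).indicator (fun _ => (1 : ℂ))) p
      ((sphereMeasure n).map Subtype.val) :=
    memLp_indicator_const p hB' 1 (Or.inr (measure_ne_top _ _))
  obtain ⟨b, hbc, hbs, hb⟩ := hf.exist_eLpNorm_sub_le hp hp1 hε
  refine ⟨b, hbc, hbs, ?_⟩
  rw [← eLpNorm_comp_measurePreserving (hf.aestronglyMeasurable.sub
    hbs.continuous.aestronglyMeasurable) hmp] at hb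
  refine le_trans (le_of_eq (eLpNorm_congr_ae (Filter.Eventually.of_forall fun θ => ?_))) hb
  by_cases h : θ ∈ B <;> simp [h]

/-- Every `L^p`-function on the cylinder belongs to the sinogram space if the weight is
continuous. -/
theorem sinogramSpace_eq_top (s : ℝ) {t : ℝ} (ht : 0 ≤ t) {p : ℝ≥0∞} [Fact (1 ≤ p)]
    (hp : p ≠ ∞) : SinogramSpace n s t p = ⊤ := by
  have hp1 : 1 ≤ p := Fact.out
  have hp0 : p ≠ 0 := (zero_lt_one.trans_le hp1).ne'
  refine eq_top_of_indicator_prod_mem (μ := (volume : Measure ℝ)) (ν := sphereMeasure n)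
    (m := cylinderMeasure n) hp (by rw [cylinderMeasure])
    (Submodule.isClosed_topologicalClosure _) fun A B hA hB hμA hAB => ?_
  rw [SinogramSpace, ← SetLike.mem_coe, Submodule.topologicalClosure_coe, Metric.mem_closure_iff]
  intro ε hε
  set v : ℝ → ℝ := vWeight s t with hv
  have hvc : Continuous v := continuous_vWeight s ht
  have hfA : MemLp (A.indicator fun _ => (1 : ℂ)) p (volume : Measure ℝ) :=
    memLp_indicator_const p hA 1 (Or.inr hμA)
  have hfB : MemLp (B.indicator fun _ => (1 : ℂ)) p (sphereMeasure n) :=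
    memLp_indicator_const p hB 1 (Or.inr (measure_ne_top _ _))
  set S := (eLpNorm (B.indicator fun _ => (1 : ℂ)) p (sphereMeasure n)).toReal with hS
  have hS0 : 0 ≤ S := ENNReal.toReal_nonneg
  have hSe : eLpNorm (B.indicator fun _ => (1 : ℂ)) p (sphereMeasure n) = ENNReal.ofReal S :=
    (ENNReal.ofReal_toReal hfB.2.ne).symm
  -- The difference of products telescopes into two terms, each at most `ε/4`. The tolerance for `φ`
  -- involves the norm `S` of the second factor; the one for `b` involves the norm `K` of `v φ` and
  -- is therefore chosen afterwards. The summand `1` guards against division by `0`.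
  obtain ⟨φ, hφc, hφs, hφ⟩ := exists_eLpNorm_sub_mul_le hvc (vWeight_nonneg s t) (by
      have : ∀ᵐ x : ℝ, x ≠ 0 := by simp [ae_iff]
      filter_upwards [this] with x hx using (vWeight_pos s t hx).ne') hp1 hp
    (measurable_const.indicator hA) hfA (ε := ε / (4 * (S + 1))) (by positivity)
  have hvφ : MemLp (fun τ => (v τ : ℂ) * φ τ) p volume :=
    Continuous.memLp_of_hasCompactSupport
      ((Complex.continuous_ofReal.comp hvc).mul hφs.continuous) hφc.mul_left
  set K := (eLpNorm (fun τ => (v τ : ℂ) * φ τ) p volume).toReal with hK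
  have hK0 : 0 ≤ K := ENNReal.toReal_nonneg
  have hKe : eLpNorm (fun τ => (v τ : ℂ) * φ τ) p volume = ENNReal.ofReal K :=
    (ENNReal.ofReal_toReal hvφ.2.ne).symm
  obtain ⟨b, hbc, hbs, hb⟩ := exists_eLpNorm_sphere_indicator_sub_le hB hp1 hp
    (ε := ε / (4 * (K + 1))) (by positivity)
  have hbcont : Continuous fun θ : Sph n => b θ := hbs.continuous.comp continuous_subtype_val
  have hbm : AEStronglyMeasurable (fun θ : Sph n => b θ) (sphereMeasure n) :=
    hbcont.aestronglyMeasurable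
  have hbL : MemLp (fun θ : Sph n => b θ) p (sphereMeasure n) := by
    have h1 : MemLp (fun θ : Sph n => B.indicator (fun _ => (1 : ℂ)) θ - b θ) p (sphereMeasure n) :=
      ⟨hfB.aestronglyMeasurable.sub hbm, hb.trans_lt ENNReal.ofReal_lt_top⟩
    convert hfB.sub h1 using 1
    ext θ
    simp
  have hprod : MemLp (fun z : ℝ × Sph n => ((v z.1 : ℂ) * φ z.1) * b z.2) p
      (cylinderMeasure n) := by
    refine ⟨?_, ?_⟩
    · exact (hvφ.aestronglyMeasurable.comp_fst).mul (hbm.comp_snd)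
    · rw [cylinderMeasure, eLpNorm_prod_mul hp0 hp hvφ.aestronglyMeasurable hbm]
      exact ENNReal.mul_lt_top hvφ.2 hbL.2
  refine ⟨hprod.toLp, Submodule.subset_span ?_, ?_⟩
  · set φS : 𝓢(ℝ, ℂ) := hφc.toSchwartzMap hφs
    set bS : 𝓢(E n, ℂ) := hbc.toSchwartzMap hbs
    -- Taking the inverse transform in `σ` makes the weighted transform of the sinogram `a ⊗ b`
    -- equal to `v φ ⊗ b`.
    set a : 𝓢(ℝ, ℂ) := 𝓕⁻ φS with ha
    refine ⟨fun σ θ => a σ * bS θ, ⟨schwartzTensor a bS, fun σ θ => rfl⟩, ?_⟩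
    refine hprod.coeFn_toLp.trans (Filter.Eventually.of_forall fun z => ?_)
    have h1 : 𝓕 (fun σ => a σ * bS z.2) z.1 = φ z.1 * b z.2 := by
      have h2 : 𝓕 (fun σ => a σ * bS z.2) z.1 = 𝓕 (a : ℝ → ℂ) z.1 * bS z.2 := by
        rw [Real.fourier_eq, Real.fourier_eq, ← integral_mul_const]
        simp only [Circle.smul_def, smul_eq_mul, mul_assoc]
      rw [h2, ← SchwartzMap.fourier_coe, ha, FourierTransform.fourier_fourierInv_eq]
      rfl
    rw [weightedFourier, h1]
    exact mul_assoc _ _ _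
  · rw [Lp.dist_def]
    have hbound : eLpNorm (fun z : ℝ × Sph n => (A ×ˢ B).indicator (fun _ => (1 : ℂ)) z -
        ((v z.1 : ℂ) * φ z.1) * b z.2) p (cylinderMeasure n) ≤
        ENNReal.ofReal (ε / 2) := by
      have e : (fun z : ℝ × Sph n => (A ×ˢ B).indicator (fun _ => (1 : ℂ)) z -
          ((v z.1 : ℂ) * φ z.1) * b z.2) =
          (fun z : ℝ × Sph n => (A.indicator (fun _ => (1 : ℂ)) z.1 - (v z.1 : ℂ) * φ z.1) *
            B.indicator (fun _ => (1 : ℂ)) z.2) +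
          (fun z : ℝ × Sph n => ((v z.1 : ℂ) * φ z.1) *
            (B.indicator (fun _ => (1 : ℂ)) z.2 - b z.2)) := by
        ext z
        by_cases h1 : z.1 ∈ A <;> by_cases h2 : z.2 ∈ B <;>
          simp [Set.indicator, Set.mem_prod, h1, h2] <;> ring
      have m1 : AEStronglyMeasurable (fun τ : ℝ => A.indicator (fun _ => (1 : ℂ)) τ -
          (v τ : ℂ) * φ τ) volume := hfA.aestronglyMeasurable.sub hvφ.aestronglyMeasurable
      have m2 : AEStronglyMeasurable (fun θ : Sph n => B.indicator (fun _ => (1 : ℂ)) θ - b θ)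
          (sphereMeasure n) := hfB.aestronglyMeasurable.sub hbm
      rw [e, cylinderMeasure]
      refine (eLpNorm_add_le (by exact m1.comp_fst.mul hfB.aestronglyMeasurable.comp_snd)
        (by exact hvφ.aestronglyMeasurable.comp_fst.mul m2.comp_snd) hp1).trans ?_
      rw [eLpNorm_prod_mul hp0 hp m1 hfB.aestronglyMeasurable,
        eLpNorm_prod_mul hp0 hp hvφ.aestronglyMeasurable m2, hSe, hKe]
      refine (add_le_add (mul_le_mul_left hφ _) (mul_le_mul_right hb _)).trans ?_
      rw [← ENNReal.ofReal_mul (by positivity), ← ENNReal.ofReal_mul (by positivity),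
        ← ENNReal.ofReal_add (by positivity) (by positivity)]
      refine ENNReal.ofReal_le_ofReal ?_
      have h1 : ε / (4 * (S + 1)) * S ≤ ε / 4 := by
        rw [div_mul_eq_mul_div, div_le_div_iff₀ (by positivity) (by norm_num)]
        nlinarith
      have h2 : K * (ε / (4 * (K + 1))) ≤ ε / 4 := by
        rw [mul_div_assoc', div_le_div_iff₀ (by positivity) (by norm_num)]
        nlinarith
      linarith
    refine lt_of_le_of_lt (ENNReal.toReal_le_of_le_ofReal (by positivity)
      (le_trans (le_of_eq (eLpNorm_congr_ae ?_)) hbound)) (half_lt_self hε)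
    filter_upwards [hprod.coeFn_toLp, indicatorConstLp_coeFn (p := p) (hs := hA.prod hB)
      (hμs := hAB) (c := (1 : ℂ))] with z h1 h2
    rw [Pi.sub_apply, h1, h2]

end SinogramDensity

/-! ### Extension of bounded operators from Schwartz functions to `L^p` -/

section Extension

variable {V : Type*} [NormedAddCommGroup V] [InnerProductSpace ℝ V] [FiniteDimensional ℝ V]
  [MeasurableSpace V] [BorelSpace V]

theorem locallyIntegrable_of_integrable_schwartz_mul {μ : Measure V} {f : V → ℂ}
    (h : ∀ ψ : 𝓢(V, ℂ), Integrable (fun x => ψ x * f x) μ) : LocallyIntegrable f μ := by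
  intro x
  let b : ContDiffBump x := ⟨1, 2, one_pos, one_lt_two⟩
  have hb₁ : HasCompactSupport (Complex.ofRealCLM ∘ b) := b.hasCompactSupport.comp_left rfl
  have hb₂ : ContDiff ℝ (⊤ : ℕ∞) (Complex.ofRealCLM ∘ b) :=
    Complex.ofRealCLM.contDiff.comp b.contDiff
  refine ⟨Metric.closedBall x 1, Metric.closedBall_mem_nhds x one_pos, ?_⟩
  refine ((h (hb₁.toSchwartzMap hb₂)).integrableOn (s := Metric.closedBall x 1)).congr_fun
    (fun y hy => ?_) Metric.isClosed_closedBall.measurableSet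
  have : b y = 1 := b.one_of_mem_closedBall hy
  simp [this]

/-- A linear map given by Fourier multiplication that is bounded from `L^p` to `L^q(μ)` on
Schwartz functions extends to `L^p`. -/
theorem exists_extension_of_eLpNorm_le {p q : ℝ≥0∞} [Fact (1 ≤ p)] [Fact (1 ≤ q)] (hp : p ≠ ∞)
    {μ : Measure V} (T : 𝓢(V, ℂ) →ₗ[ℂ] V → ℂ) (hm : ∀ φ, AEStronglyMeasurable (T φ) μ) (C : ℝ≥0)
    (hT : ∀ φ, eLpNorm (T φ) q μ ≤ C * eLpNorm φ p volume) :
    ∃ U : Lp ℂ p (volume : Measure V) →L[ℂ] Lp ℂ q μ,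
      ∀ φ : 𝓢(V, ℂ), (U (φ.toLp p) : V → ℂ) =ᵐ[μ] T φ := by
  have hmem : ∀ φ, MemLp (T φ) q μ := fun φ =>
    ⟨hm φ, (hT φ).trans_lt (ENNReal.mul_lt_top ENNReal.coe_lt_top (φ.memLp p volume).2)⟩
  let T' : 𝓢(V, ℂ) →ₗ[ℂ] Lp ℂ q μ :=
    { toFun := fun φ => (hmem φ).toLp
      map_add' := fun φ ψ => by
        rw [← MemLp.toLp_add (hmem φ) (hmem ψ)]
        exact MemLp.toLp_congr _ _ (by rw [map_add])
      map_smul' := fun c φ => by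
        rw [RingHom.id_apply, ← MemLp.toLp_const_smul c (hmem φ)]
        exact MemLp.toLp_congr _ _ (by rw [map_smul]) }
  obtain ⟨e, he⟩ : ∃ e : 𝓢(V, ℂ) →ₗ[ℂ] Lp ℂ p (volume : Measure V), ∀ φ, e φ = φ.toLp p :=
    ⟨(SchwartzMap.toLpCLM ℂ ℂ p (volume : Measure V)).toLinearMap, fun φ => rfl⟩
  have hd : DenseRange e := by
    have h : (e : 𝓢(V, ℂ) → Lp ℂ p (volume : Measure V)) = fun φ => φ.toLp p := funext he
    rw [h]
    exact SchwartzMap.denseRange_toLpCLM (E := V) (F := ℂ) hp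
  have hT' : ∀ φ, T' φ = (hmem φ).toLp := fun φ => rfl
  have hb : ∀ φ, ‖T' φ‖ ≤ C * ‖e φ‖ := by
    intro φ
    rw [hT', he, Lp.norm_toLp, SchwartzMap.toLp, Lp.norm_toLp]
    have := ENNReal.toReal_mono (ENNReal.mul_ne_top ENNReal.coe_ne_top (φ.memLp p volume).2.ne) (hT φ)
    rwa [ENNReal.toReal_mul, ENNReal.coe_toReal] at this
  refine ⟨T'.extendOfNorm e, fun φ => ?_⟩
  rw [← he, LinearMap.extendOfNorm_eq hd ⟨C, hb⟩ φ, hT']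
  exact (hmem φ).coeFn_toLp

end Extension

/-! ### The polar kernel: Paley bound, injectivity and pairing identity -/

variable {n : ℕ}

theorem ae_polarMeasure_ne_zero (hn : 1 ≤ n) : ∀ᵐ ξ ∂(polarMeasure n), ξ ≠ 0 := by
  have : Nontrivial (E n) := Module.nontrivial_of_finrank_pos (R := ℝ) (by simp; omega)
  rw [polarMeasure_eq_withDensity hn]
  refine (withDensity_absolutelyContinuous _ _).ae_le ?_
  exact Measure.ae_ne volume 0

/-- The function `½ |ξ|^{n-1-t} 𝓕⁻¹φ(ξ)`, which pairs with `v_{s,t} 𝓕f` in the polar measure to the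
pairing of `φ` with a Bessel potential of `f`. -/
noncomputable def polarKernel (n : ℕ) (t : ℝ) : 𝓢(E n, ℂ) →ₗ[ℂ] E n → ℂ where
  toFun φ ξ := ((1 / 2 * ‖ξ‖ ^ ((n : ℝ) - 1 - t) : ℝ) : ℂ) * 𝓕⁻ φ ξ
  map_add' φ ψ := by ext ξ; simp [FourierTransform.fourierInv_add, mul_add]
  map_smul' c φ := by ext ξ; simp [FourierTransform.fourierInv_smul]; ring

theorem polarKernel_apply (t : ℝ) (φ : 𝓢(E n, ℂ)) (ξ : E n) :
    polarKernel n t φ ξ = ((1 / 2 * ‖ξ‖ ^ ((n : ℝ) - 1 - t) : ℝ) : ℂ) * 𝓕⁻ φ ξ := rfl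

theorem measurable_polarKernel (t : ℝ) (φ : 𝓢(E n, ℂ)) : Measurable (polarKernel n t φ) := by
  have h : Measurable fun ξ : E n => ((1 / 2 * ‖ξ‖ ^ ((n : ℝ) - 1 - t) : ℝ) : ℂ) :=
    Complex.measurable_ofReal.comp (by fun_prop)
  exact h.mul (𝓕⁻ φ).continuous.measurable

/-- This is Paley's inequality: by `P/Q = P - 1`, the factor `|ξ|^{P(n-1-t)}` times the density
`|ξ|^{-(n-1)}` is exactly `|ξ|^{-n(2-P)}`. The inverse transform is the transform reflected in the
origin, which does not change the integral. -/
theorem exists_eLpNorm_polarKernel_le (hn : 1 ≤ n) {p q : ℝ≥0∞} (hpq : p.HolderConjugate q)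
    (hp : 1 < p) (hp2 : p ≤ 2) : ∃ C : ℝ≥0, ∀ φ : 𝓢(E n, ℂ),
      eLpNorm (polarKernel n (((n : ℝ) * q.toReal - n - 1) / q.toReal) φ) p (polarMeasure n) ≤
        C * eLpNorm φ p volume := by
  have : Nontrivial (E n) := Module.nontrivial_of_finrank_pos (R := ℝ) (by simp; omega)
  obtain ⟨hc, hP1, hP2, hQ2, hptop, hqtop⟩ := holderConjugate_toReal_of_one_lt hpq hp hp2
  obtain ⟨C, hC⟩ := exists_lintegral_fourier_rpow_mul_norm_rpow_le (V := E n) hP1 hP2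
  set P := p.toReal with hP
  set Q := q.toReal with hQ
  have hP0 : 0 < P := by linarith
  have hQ0 : 0 < Q := by linarith
  refine ⟨(2 * C) ^ (1 / P), fun φ => ?_⟩
  set t : ℝ := ((n : ℝ) * Q - n - 1) / Q with ht
  have hexp : P * ((n : ℝ) - 1 - t) - ((n : ℝ) - 1) = -(n * (2 - P)) := by
    have h2 : P * (1 / Q) = P - 1 := by
      have := hc.inv_add_inv_eq_one
      field_simp at this ⊢
      linarith
    have h3 : t = n - (n + 1) * (1 / Q) := by rw [ht]; field_simp; ring
    rw [h3]
    linear_combination (n + 1) * h2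
  have hp0 : p ≠ 0 := hpq.ne_zero
  rw [eLpNorm_eq_lintegral_rpow_enorm_toReal hp0 hptop, eLpNorm_eq_lintegral_rpow_enorm_toReal hp0 hptop,
    ← hP, lintegral_polarMeasure hn ((measurable_polarKernel t φ).enorm.pow_const P),
    ENNReal.coe_rpow_of_nonneg _ (by positivity), ← ENNReal.mul_rpow_of_nonneg _ _ (by positivity)]
  refine ENNReal.rpow_le_rpow ?_ (by positivity)
  rw [ENNReal.coe_mul, ENNReal.coe_ofNat, mul_assoc]
  gcongr 2 * ?_
  have hR : ∫⁻ x, ‖φ x‖ₑ ^ P = ∫⁻ x, ENNReal.ofReal (‖φ x‖ ^ P) := by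
    refine lintegral_congr fun x => ?_
    rw [← ENNReal.ofReal_rpow_of_nonneg (norm_nonneg _) hP0.le, ofReal_norm]
  rw [hR]
  refine le_trans ?_ (hC φ)
  rw [← lintegral_neg_eq_self (μ := (volume : Measure (E n)))
    (fun ξ => ENNReal.ofReal (‖𝓕 (φ : E n → ℂ) ξ‖ ^ P * ‖ξ‖ ^ (-(Module.finrank ℝ (E n) * (2 - P)) : ℝ)))]
  refine lintegral_mono_ae ?_
  filter_upwards [Measure.ae_ne (volume : Measure (E n)) 0] with ξ hξ
  have hξ0 : 0 < ‖ξ‖ := norm_pos_iff.2 hξ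
  rw [← ofReal_norm, ENNReal.ofReal_rpow_of_nonneg (norm_nonneg _) hP0.le,
    ← ENNReal.ofReal_mul (by positivity), polarKernel_apply, SchwartzMap.fourierInv_coe,
    Real.fourierInv_eq_fourier_neg]
  refine ENNReal.ofReal_le_ofReal ?_
  rw [norm_mul, Complex.norm_real, Real.norm_of_nonneg (by positivity), norm_neg, finrank_euclideanSpace,
    Fintype.card_fin, ← hexp, Real.mul_rpow (by positivity) (by positivity),
    Real.mul_rpow (by positivity) (by positivity), ← Real.rpow_mul hξ0.le, mul_comm P, sub_eq_add_neg _ ((n : ℝ) - 1),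
    Real.rpow_add hξ0]
  have h1 : ((1 : ℝ) / 2) ^ P ≤ 1 := Real.rpow_le_one (by norm_num) (by norm_num) hP0.le
  calc (1 / 2 : ℝ) ^ P * ‖ξ‖ ^ (((n : ℝ) - 1 - t) * P) * ‖𝓕 (φ : E n → ℂ) (-ξ)‖ ^ P * ‖ξ‖ ^ (-((n : ℝ) - 1))
      ≤ 1 * ‖ξ‖ ^ (((n : ℝ) - 1 - t) * P) * ‖𝓕 (φ : E n → ℂ) (-ξ)‖ ^ P * ‖ξ‖ ^ (-((n : ℝ) - 1)) := by
        gcongr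
    _ = _ := by ring

/-- Choosing `φ = 𝓕 ψ` turns the kernel into `ψ` times a power of `|ξ|` that vanishes nowhere off
the origin, a null set; `ψ` is then arbitrary. This yields uniqueness of the Radon transform. -/
theorem ae_eq_zero_of_integral_polarKernel_mul_eq_zero (hn : 1 ≤ n) (t : ℝ) {F : E n → ℂ}
    (hF : ∀ φ : 𝓢(E n, ℂ), Integrable (fun ξ => polarKernel n t φ ξ * F ξ) (polarMeasure n))
    (h0 : ∀ φ : 𝓢(E n, ℂ), ∫ ξ, polarKernel n t φ ξ * F ξ ∂(polarMeasure n) = 0) :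
    ∀ᵐ ξ ∂(polarMeasure n), F ξ = 0 := by
  set w : E n → ℂ := fun ξ => ((1 / 2 * ‖ξ‖ ^ ((n : ℝ) - 1 - t) : ℝ) : ℂ) with hw
  have key : ∀ (ψ : 𝓢(E n, ℂ)) (ξ : E n), polarKernel n t (𝓕 ψ) ξ * F ξ = ψ ξ * (w ξ * F ξ) := by
    intro ψ ξ
    rw [polarKernel_apply, FourierTransform.fourierInv_fourier_eq]
    ring
  have hi : ∀ ψ : 𝓢(E n, ℂ), Integrable (fun ξ => ψ ξ * (w ξ * F ξ)) (polarMeasure n) := fun ψ => by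
    simpa only [key] using hF (𝓕 ψ)
  have := ae_eq_zero_of_integral_schwartz_mul_eq_zero
    (locallyIntegrable_of_integrable_schwartz_mul hi) fun ψ => by simpa only [key] using h0 (𝓕 ψ)
  filter_upwards [this, ae_polarMeasure_ne_zero hn] with ξ h1 h2
  have h3 : 0 < ‖ξ‖ := norm_pos_iff.2 h2
  refine (mul_eq_zero.1 h1).resolve_left ?_
  rw [hw]
  exact Complex.ofReal_ne_zero.2 (by positivity)

theorem vWeight_eq {V : Type*} [NormedAddCommGroup V] (s t : ℝ) (ξ : V) :
    vWeight s t ξ = (1 + ‖ξ‖ ^ 2) ^ ((s - t) / 2) * ‖ξ‖ ^ t := by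
  have h : 0 < 1 + ‖ξ‖ ^ 2 := by positivity
  rw [vWeight, Real.div_rpow (norm_nonneg _) (by positivity), ← Real.rpow_mul h.le, sub_div,
    Real.rpow_sub h, one_div, inv_mul_eq_div]
  ring

theorem exists_Lp_mul_pairing {α : Type*} [MeasurableSpace α] (μ : Measure α) {p q : ℝ≥0∞}
    [Fact (1 ≤ p)] [Fact (1 ≤ q)] (hpq : p.HolderConjugate q) :
    ∃ B : Lp ℂ p μ →L[ℂ] Lp ℂ q μ →L[ℂ] ℂ, ∀ a b, B a b = ∫ x, a x * b x ∂μ :=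
  ⟨(ContinuousLinearMap.mul ℂ ℂ).lpPairing μ p q, fun a b =>
    ContinuousLinearMap.lpPairing_eq_integral _ a b⟩

/-- The Hölder conjugate exponents determine a bounded lift of polar `L^q` densities to `L^q`. -/
theorem exists_Lp_repr_polarKernel (hn : 1 ≤ n) {p q : ℝ≥0∞} [Fact (1 ≤ p)] [Fact (1 ≤ q)]
    (hpq : p.HolderConjugate q) (hp : 1 < p) (hp2 : p ≤ 2) :
    ∃ C : ℝ≥0, ∀ H : Lp ℂ q (polarMeasure n), ∃ g : Lp ℂ q (volume : Measure (E n)), ‖g‖ ≤ C * ‖H‖ ∧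
      ∀ φ : 𝓢(E n, ℂ), ∫ x, φ x * g x =
        ∫ ξ, polarKernel n (((n : ℝ) * q.toReal - n - 1) / q.toReal) φ ξ * H ξ ∂(polarMeasure n) := by
  obtain ⟨hc, hP1, hP2, hQ2, hptop, hqtop⟩ := holderConjugate_toReal_of_one_lt hpq hp hp2
  obtain ⟨C, hC⟩ := exists_eLpNorm_polarKernel_le hn hpq hp hp2
  obtain ⟨K, hK⟩ := exists_extension_of_eLpNorm_le hptop
    (polarKernel n (((n : ℝ) * q.toReal - n - 1) / q.toReal))
    (fun φ => (measurable_polarKernel _ φ).aestronglyMeasurable) C hC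
  obtain ⟨B, hB⟩ := exists_Lp_mul_pairing (polarMeasure n) hpq
  refine ⟨‖B‖₊ * ‖K‖₊, fun H => ?_⟩
  -- The lift `g` is the adjoint of the extended kernel operator `K` applied to `H`.
  obtain ⟨g, hg, hgφ⟩ := exists_Lp_repr_of_functional hpq hp hp2 ((B.flip H) ∘L K)
  refine ⟨g, hg.trans ?_, fun φ => ?_⟩
  · calc ‖(B.flip H) ∘L K‖ ≤ ‖B.flip H‖ * ‖K‖ := ContinuousLinearMap.opNorm_comp_le _ _
      _ ≤ (‖B‖ * ‖H‖) * ‖K‖ := by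
        gcongr
        exact (B.flip.le_opNorm H).trans_eq (by rw [ContinuousLinearMap.opNorm_flip])
      _ = _ := by simp; ring
  · rw [← hgφ φ]
    change B (K (φ.toLp p)) H = _
    rw [hB]
    refine integral_congr_ae ?_
    filter_upwards [hK φ] with ξ h
    rw [h]

/-- Off the origin the density `2|ξ|^{-(n-1)}`, the factor `½|ξ|^{n-1-t}` of the kernel and the
factor `|ξ|^t` of `v_{s,t}` multiply to `1`. What remains is `(1+|ξ|²)^{(s-t)/2} 𝓕 f 𝓕⁻¹ φ`, and the
multiplication formula moves the transform off `f`. -/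
theorem besselPotential_toL1_eq_integral_polarKernel (hn : 1 ≤ n) (s t : ℝ) {f : E n → ℂ}
    (hf : Integrable f) (φ : 𝓢(E n, ℂ)) :
    Integrable (fun ξ => polarKernel n t φ ξ * ((vWeight s t ξ : ℂ) * 𝓕 f ξ)) (polarMeasure n) ∧
      TemperedDistribution.besselPotential (E n) ℂ (s - t)
          (Lp.toTemperedDistribution (hf.toL1 f)) φ =
        ∫ ξ, polarKernel n t φ ξ * ((vWeight s t ξ : ℂ) * 𝓕 f ξ) ∂(polarMeasure n) := by
  have : Nontrivial (E n) := Module.nontrivial_of_finrank_pos (R := ℝ) (by simp; omega)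
  set ψ : 𝓢(E n, ℂ) := SchwartzMap.smulLeftCLM ℂ
    (fun x : E n => (((1 + ‖x‖ ^ 2) ^ ((s - t) / 2) : ℝ) : ℂ)) (𝓕⁻ φ) with hψ
  have hψx : ∀ x, ψ x = (((1 + ‖x‖ ^ 2) ^ ((s - t) / 2) : ℝ) : ℂ) * 𝓕⁻ φ x := fun x => by
    rw [hψ, SchwartzMap.smulLeftCLM_apply_apply (by fun_prop), smul_eq_mul]
  have hdm : Measurable fun ξ : E n => 2 * ENNReal.ofReal (‖ξ‖ ^ (-((n : ℝ) - 1))) := by fun_prop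
  have hdt : ∀ᵐ ξ : E n, 2 * ENNReal.ofReal (‖ξ‖ ^ (-((n : ℝ) - 1))) < ∞ :=
    Filter.Eventually.of_forall fun ξ => ENNReal.mul_lt_top (by simp) ENNReal.ofReal_lt_top
  have key : (fun ξ => (2 * ENNReal.ofReal (‖ξ‖ ^ (-((n : ℝ) - 1)))).toReal •
      (polarKernel n t φ ξ * ((vWeight s t ξ : ℂ) * 𝓕 f ξ))) =ᵐ[volume] fun ξ => 𝓕 f ξ * ψ ξ := by
    filter_upwards [Measure.ae_ne (volume : Measure (E n)) 0] with ξ hξ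
    have hξ0 : 0 < ‖ξ‖ := norm_pos_iff.2 hξ
    have h1 : ‖ξ‖ ^ (-((n : ℝ) - 1)) * (‖ξ‖ ^ ((n : ℝ) - 1 - t) * ‖ξ‖ ^ t) = 1 := by
      rw [← Real.rpow_add hξ0, ← Real.rpow_add hξ0, sub_add_cancel, neg_add_cancel, Real.rpow_zero]
    have h2 : ((‖ξ‖ ^ (-((n : ℝ) - 1)) * (‖ξ‖ ^ ((n : ℝ) - 1 - t) * ‖ξ‖ ^ t) : ℝ) : ℂ) = 1 := by
      rw [h1]; rfl
    push_cast at h2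
    rw [ENNReal.toReal_mul, ENNReal.toReal_ofReal (by positivity), polarKernel_apply, vWeight_eq, hψx,
      Complex.real_smul]
    simp only [ENNReal.toReal_ofNat, Complex.ofReal_mul, Complex.ofReal_div, Complex.ofReal_ofNat,
      Complex.ofReal_one]
    linear_combination (𝓕⁻ φ ξ * 𝓕 f ξ * (((1 + ‖ξ‖ ^ 2) ^ ((s - t) / 2) : ℝ) : ℂ)) * h2
  have hint : Integrable fun ξ => 𝓕 f ξ * ψ ξ := by
    refine Integrable.bdd_mul (c := ∫ x, ‖f x‖) (ψ.integrable) ?_ ?_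
    · exact (continuous_fourier_of_integrable hf).aestronglyMeasurable
    · exact Filter.Eventually.of_forall fun ξ => norm_fourier_le_integral_norm f ξ
  refine ⟨?_, ?_⟩
  · rw [polarMeasure_eq_withDensity hn, integrable_withDensity_iff_integrable_smul' hdm hdt]
    exact hint.congr key.symm
  · rw [polarMeasure_eq_withDensity hn, integral_withDensity_eq_integral_toReal_smul hdm hdt,
      integral_congr_ae key, integral_fourier_mul_eq_of_integrable hf ψ.integrable,
      TemperedDistribution.besselPotential, TemperedDistribution.fourierMultiplierCLM_apply_apply,
      Lp.toTemperedDistribution_apply, ← hψ]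
    refine integral_congr_ae ?_
    filter_upwards [hf.coeFn_toL1] with x hx
    rw [hx, SchwartzMap.fourier_coe, smul_eq_mul, mul_comm]

/-- The Hausdorff–Young part of the upper bound: `h ↦ v_{s,t} 𝓕 ⟨D⟩^{-s} h` is bounded from `L^p`
to the polar `L^q` space. -/
theorem exists_vWeight_fourier_extension (hn : 1 ≤ n) {p q : ℝ≥0∞} [Fact (1 ≤ p)] [Fact (1 ≤ q)]
    (hpq : p.HolderConjugate q) (hp : 1 < p) (hp2 : p ≤ 2) (s : ℝ) :
    ∃ U : Lp ℂ p (volume : Measure (E n)) →L[ℂ] Lp ℂ q (polarMeasure n), ∀ h : 𝓢(E n, ℂ),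
      (U (h.toLp p) : E n → ℂ) =ᵐ[polarMeasure n] fun ξ =>
        (vWeight (s + ((n : ℝ) - 1) / q.toReal) (((n : ℝ) * q.toReal - n - 1) / q.toReal) ξ : ℂ) *
          ((((1 + ‖ξ‖ ^ 2) ^ (-s / 2) : ℝ) : ℂ) * 𝓕 h ξ) := by
  have : Nontrivial (E n) := Module.nontrivial_of_finrank_pos (R := ℝ) (by simp; omega)
  obtain ⟨hc, hP1, hP2, hQ2, hptop, hqtop⟩ := holderConjugate_toReal_of_one_lt hpq hp hp2
  set Q := q.toReal with hQ
  have hQ0 : 0 < Q := by linarith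
  set r := s + ((n : ℝ) - 1) / Q with hr
  set t := ((n : ℝ) * Q - n - 1) / Q with ht
  let T : 𝓢(E n, ℂ) →ₗ[ℂ] E n → ℂ :=
    { toFun := fun h ξ => (vWeight r t ξ : ℂ) * ((((1 + ‖ξ‖ ^ 2) ^ (-s / 2) : ℝ) : ℂ) * 𝓕 h ξ)
      map_add' := fun φ ψ => by ext ξ; simp [FourierTransform.fourier_add, mul_add]
      map_smul' := fun c φ => by ext ξ; simp [FourierTransform.fourier_smul]; ring }
  have hTx : ∀ h ξ, T h ξ = (vWeight r t ξ : ℂ) * ((((1 + ‖ξ‖ ^ 2) ^ (-s / 2) : ℝ) : ℂ) * 𝓕 h ξ) :=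
    fun _ _ => rfl
  have hTm : ∀ h, Measurable (T h) := by
    intro h
    have h1 : Measurable fun ξ : E n => (vWeight r t ξ : ℂ) :=
      Complex.measurable_ofReal.comp (measurable_vWeight r t)
    have h2 : Measurable fun ξ : E n => (((1 + ‖ξ‖ ^ 2) ^ (-s / 2) : ℝ) : ℂ) :=
      Complex.measurable_ofReal.comp (by fun_prop)
    exact h1.mul (h2.mul (𝓕 h).continuous.measurable)
  refine exists_extension_of_eLpNorm_le hptop T (fun h => (hTm h).aestronglyMeasurable)
    (2 ^ (1 / Q) * paleyConst p.toReal ^ (1 / p.toReal)) fun h => ?_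
  have hHY := eLpNorm_fourier_le hpq hp hp2 h
  have hpos : 0 ≤ 1 / p.toReal := by positivity
  calc eLpNorm (T h) q (polarMeasure n) ≤ 2 ^ (1 / Q) * eLpNorm (𝓕 (h : E n → ℂ)) q volume := by
        rw [eLpNorm_eq_lintegral_rpow_enorm_toReal hpq.symm.ne_zero hqtop,
          eLpNorm_eq_lintegral_rpow_enorm_toReal hpq.symm.ne_zero hqtop, ← hQ,
          lintegral_polarMeasure hn ((hTm h).enorm.pow_const Q),
          ← ENNReal.mul_rpow_of_nonneg _ _ (by positivity)]
        refine ENNReal.rpow_le_rpow ?_ (by positivity)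
        gcongr 2 * ?_
        refine lintegral_mono_ae ?_
        filter_upwards [Measure.ae_ne (volume : Measure (E n)) 0] with ξ hξ
        have hξ0 : 0 < ‖ξ‖ := norm_pos_iff.2 hξ
        have hJ : 0 < 1 + ‖ξ‖ ^ 2 := by positivity
        rw [← ofReal_norm, ← ofReal_norm, ENNReal.ofReal_rpow_of_nonneg (norm_nonneg _) hQ0.le,
          ENNReal.ofReal_rpow_of_nonneg (norm_nonneg _) hQ0.le, ← ENNReal.ofReal_mul (by positivity),
          hTx, SchwartzMap.fourier_coe]
        refine ENNReal.ofReal_le_ofReal ?_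
        rw [norm_mul, norm_mul, Complex.norm_real, Complex.norm_real,
          Real.norm_of_nonneg (vWeight_nonneg _ _ _), Real.norm_of_nonneg (by positivity), vWeight_eq]
        -- All weights, including the polar density without its factor `2`, combine to
        -- `(|ξ|²/(1+|ξ|²))^{a/2}`, which is at most `1` because `Q ≥ 2`.
        set a : ℝ := (n : ℝ) * (Q - 2) with ha
        have ha0 : 0 ≤ a := mul_nonneg (by positivity) (by linarith)
        have e1 : ((r - t) / 2 + -s / 2) * Q = -(a / 2) := by
          rw [hr, ht, ha]; field_simp; ring
        have e2 : t * Q + (-((n : ℝ) - 1)) = a := by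
          rw [ht, ha]; field_simp; ring
        have h1 : (((1 + ‖ξ‖ ^ 2) ^ ((r - t) / 2) * ‖ξ‖ ^ t) * ((1 + ‖ξ‖ ^ 2) ^ (-s / 2))) ^ Q *
            ‖ξ‖ ^ (-((n : ℝ) - 1)) ≤ 1 := by
          have e3 : ((1 + ‖ξ‖ ^ 2) ^ ((r - t) / 2) * ‖ξ‖ ^ t) * ((1 + ‖ξ‖ ^ 2) ^ (-s / 2)) =
              (1 + ‖ξ‖ ^ 2) ^ ((r - t) / 2 + -s / 2) * ‖ξ‖ ^ t := by
            rw [Real.rpow_add hJ]; ring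
          rw [e3, Real.mul_rpow (by positivity) (by positivity), ← Real.rpow_mul hJ.le,
            ← Real.rpow_mul hξ0.le, mul_assoc, ← Real.rpow_add hξ0, e1, e2, Real.rpow_neg hJ.le,
            inv_mul_le_one₀ (by positivity)]
          calc ‖ξ‖ ^ a = (‖ξ‖ ^ 2) ^ (a / 2) := by
                rw [← Real.rpow_natCast, ← Real.rpow_mul hξ0.le]; congr 1; push_cast; ring
            _ ≤ _ := Real.rpow_le_rpow (by positivity) (by linarith) (by linarith)
        rw [← mul_assoc, Real.mul_rpow (by positivity) (norm_nonneg _)]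
        calc _ = ((((1 + ‖ξ‖ ^ 2) ^ ((r - t) / 2) * ‖ξ‖ ^ t) * ((1 + ‖ξ‖ ^ 2) ^ (-s / 2))) ^ Q *
            ‖ξ‖ ^ (-((n : ℝ) - 1))) * ‖𝓕 (h : E n → ℂ) ξ‖ ^ Q := by ring
          _ ≤ 1 * ‖𝓕 (h : E n → ℂ) ξ‖ ^ Q := by gcongr
          _ = _ := one_mul _
    _ ≤ 2 ^ (1 / Q) * ((paleyConst p.toReal : ℝ≥0∞) ^ (1 / p.toReal) * eLpNorm h p volume) := by
        gcongr
    _ = _ := by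
        rw [ENNReal.coe_mul, ENNReal.coe_rpow_of_nonneg _ hpos,
          ENNReal.coe_rpow_of_nonneg _ (by positivity), ENNReal.coe_ofNat, mul_assoc]

/-! ### The closed graph of the Radon transform -/

theorem toTemperedDistribution_toL1 (f : 𝓢(E n, ℂ)) :
    Lp.toTemperedDistribution ((f.integrable (μ := volume)).toL1 (f : E n → ℂ)) = (f : 𝓢'(E n, ℂ)) := by
  ext φ
  rw [Lp.toTemperedDistribution_apply, SchwartzMap.coe_apply]
  refine integral_congr_ae ?_
  filter_upwards [f.integrable.coeFn_toL1] with x hx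
  rw [hx]

theorem measurable_vWeight_mul_fourier (s t : ℝ) {f : E n → ℂ} (hf : Integrable f) :
    Measurable fun ξ => (vWeight s t ξ : ℂ) * 𝓕 f ξ :=
  (Complex.measurable_ofReal.comp (measurable_vWeight s t)).mul
    (continuous_fourier_of_integrable hf).measurable

/-- Both conclusions are closed conditions on `(u, G)` that hold for Schwartz functions. The first
is closed because the range of an isometry from a complete space is closed; the second because `u`
is tested pointwise and `G` is paired with a fixed `L^p` function. -/
theorem exists_polar_of_hasRadonTransform (hn : 1 ≤ n) {p q : ℝ≥0∞} [Fact (1 ≤ p)] [Fact (1 ≤ q)]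
    (hpq : p.HolderConjugate q) {s t : ℝ}
    (hk : ∀ φ : 𝓢(E n, ℂ), MemLp (polarKernel n t φ) p (polarMeasure n))
    {u : 𝓢'(E n, ℂ)} {G : SinogramSpace n s t q} (h : HasRadonTransform u G) :
    ∃ H : Lp ℂ q (polarMeasure n),
      Lp.compMeasurePreservingₗᵢ ℂ polarMap measurePreserving_polarMap H =
        (G : Lp ℂ q (cylinderMeasure n)) ∧
      ∀ φ : 𝓢(E n, ℂ), TemperedDistribution.besselPotential (E n) ℂ (s - t) u φ =
        ∫ ξ, polarKernel n t φ ξ * H ξ ∂(polarMeasure n) := by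
  obtain ⟨J, hJ⟩ : ∃ J : Lp ℂ q (polarMeasure n) →ₗᵢ[ℂ] Lp ℂ q (cylinderMeasure n),
      J = Lp.compMeasurePreservingₗᵢ ℂ polarMap measurePreserving_polarMap := ⟨_, rfl⟩
  have hJx : ∀ H, (J H : ℝ × Sph n → ℂ) =ᵐ[cylinderMeasure n] fun z => H (polarMap z) := by
    intro H
    rw [hJ]
    exact Lp.coeFn_compMeasurePreserving H measurePreserving_polarMap
  rw [← hJ]
  obtain ⟨B, hB⟩ := exists_Lp_mul_pairing (cylinderMeasure n) hpq
  have hkc : ∀ φ : 𝓢(E n, ℂ), MemLp (fun z => polarKernel n t φ (polarMap z)) p (cylinderMeasure n) :=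
    fun φ => (hk φ).comp_measurePreserving measurePreserving_polarMap
  have hBJ : ∀ (φ : 𝓢(E n, ℂ)) (H : Lp ℂ q (polarMeasure n)),
      B (hkc φ).toLp (J H) = ∫ ξ, polarKernel n t φ ξ * H ξ ∂(polarMeasure n) := by
    intro φ H
    have hmap := integral_map (μ := cylinderMeasure n) (φ := polarMap)
      continuous_polarMap.measurable.aemeasurable (f := fun ξ => polarKernel n t φ ξ * H ξ)
      ((measurable_polarKernel t φ).aestronglyMeasurable.mul (Lp.aestronglyMeasurable H))
    rw [hB]
    refine Eq.trans (integral_congr_ae ?_) hmap.symm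
    filter_upwards [(hkc φ).coeFn_toLp, hJx H] with z h1 h2
    rw [h1, h2]
  set S : Set (𝓢'(E n, ℂ) × SinogramSpace n s t q) :=
    {x | (x.2 : Lp ℂ q (cylinderMeasure n)) ∈ Set.range J} ∩
      ⋂ φ : 𝓢(E n, ℂ), {x | TemperedDistribution.besselPotential (E n) ℂ (s - t) x.1 φ =
        B (hkc φ).toLp (x.2 : Lp ℂ q (cylinderMeasure n))} with hS
  have hSc : IsClosed S := by
    refine IsClosed.inter ?_ (isClosed_iInter fun φ => ?_)
    · exact J.isometry.isClosedEmbedding.isClosed_range.preimage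
        (continuous_subtype_val.comp continuous_snd)
    · refine isClosed_eq ?_ ?_
      · exact ((PointwiseConvergenceCLM.evalCLM (RingHom.id ℂ) ℂ φ).continuous.comp
          (TemperedDistribution.besselPotential (E n) ℂ (s - t)).continuous).comp continuous_fst
      · exact (B (hkc φ).toLp).continuous.comp (continuous_subtype_val.comp continuous_snd)
  have hmem : (u, G) ∈ S := by
    refine closure_minimal ?_ hSc h
    rintro ⟨v, G'⟩ ⟨f, hv, hG'⟩
    dsimp only at hv hG'
    have hmeas := measurable_vWeight_mul_fourier s t f.integrable
    have hcomp : ((G' : Lp ℂ q (cylinderMeasure n)) : ℝ × Sph n → ℂ) =ᵐ[cylinderMeasure n]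
        (fun ξ => (vWeight s t ξ : ℂ) * 𝓕 (f : E n → ℂ) ξ) ∘ polarMap := by
      rw [weightedFourier_radon f.integrable] at hG'
      exact hG'
    have hm : MemLp (fun ξ => (vWeight s t ξ : ℂ) * 𝓕 (f : E n → ℂ) ξ) q (polarMeasure n) := by
      refine ⟨hmeas.aestronglyMeasurable, ?_⟩
      rw [← eLpNorm_comp_measurePreserving hmeas.aestronglyMeasurable measurePreserving_polarMap,
        ← eLpNorm_congr_ae hcomp]
      exact (Lp.memLp _).2
    have hGJ : J hm.toLp = (G' : Lp ℂ q (cylinderMeasure n)) := by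
      refine Lp.ext ?_
      refine (hJx _).trans (Filter.EventuallyEq.trans ?_ hcomp.symm)
      exact measurePreserving_polarMap.quasiMeasurePreserving.ae_eq_comp hm.coeFn_toLp
    refine ⟨⟨hm.toLp, hGJ⟩, Set.mem_iInter.2 fun φ => ?_⟩
    change TemperedDistribution.besselPotential (E n) ℂ (s - t) v φ = B (hkc φ).toLp G'
    rw [hv, ← toTemperedDistribution_toL1, ← hGJ, hBJ,
      (besselPotential_toL1_eq_integral_polarKernel hn s t f.integrable φ).2]
    refine integral_congr_ae ?_
    filter_upwards [hm.coeFn_toLp] with ξ hξ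
    rw [hξ]
  obtain ⟨⟨H, hH⟩, h2⟩ := hmem
  refine ⟨H, hH, fun φ => ?_⟩
  have h3 : TemperedDistribution.besselPotential (E n) ℂ (s - t) u φ = B (hkc φ).toLp G :=
    Set.mem_iInter.1 h2 φ
  rw [h3, ← hBJ]
  exact congrArg _ hH.symm

theorem ae_eq_of_integral_polarKernel_mul_eq (hn : 1 ≤ n) (t : ℝ) {F₁ F₂ : E n → ℂ}
    (h₁ : ∀ φ, Integrable (fun ξ => polarKernel n t φ ξ * F₁ ξ) (polarMeasure n))
    (h₂ : ∀ φ, Integrable (fun ξ => polarKernel n t φ ξ * F₂ ξ) (polarMeasure n))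
    (h : ∀ φ, ∫ ξ, polarKernel n t φ ξ * F₁ ξ ∂(polarMeasure n) =
      ∫ ξ, polarKernel n t φ ξ * F₂ ξ ∂(polarMeasure n)) :
    F₁ =ᵐ[polarMeasure n] F₂ := by
  have := ae_eq_zero_of_integral_polarKernel_mul_eq_zero hn t (F := fun ξ => F₁ ξ - F₂ ξ)
    (fun φ => by simp only [mul_sub]; exact (h₁ φ).sub (h₂ φ))
    (fun φ => by simp only [mul_sub]; rw [integral_sub (h₁ φ) (h₂ φ), h φ, sub_self])
  filter_upwards [this] with ξ hξ using sub_eq_zero.1 hξ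

/-- Radon transforms of Bessel potentials of `L^p` functions. -/
theorem hasRadonTransform_of_besselPotential_eq {p q : ℝ≥0∞} [Fact (1 ≤ p)]
    [Fact (1 ≤ q)] (hp : p ≠ ∞) {s r t : ℝ} (htop : SinogramSpace n r t q = ⊤)
    {U : Lp ℂ p (volume : Measure (E n)) →L[ℂ] Lp ℂ q (polarMeasure n)}
    (hU : ∀ h : 𝓢(E n, ℂ), (U (h.toLp p) : E n → ℂ) =ᵐ[polarMeasure n] fun ξ =>
        (vWeight r t ξ : ℂ) * ((((1 + ‖ξ‖ ^ 2) ^ (-s / 2) : ℝ) : ℂ) * 𝓕 h ξ))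
    {u : 𝓢'(E n, ℂ)} {h : Lp ℂ p (volume : Measure (E n))}
    (hu : TemperedDistribution.besselPotential (E n) ℂ s u = (h : 𝓢'(E n, ℂ)))
    {G : SinogramSpace n r t q}
    (hG : Lp.compMeasurePreservingₗᵢ ℂ polarMap measurePreserving_polarMap (U h) =
      (G : Lp ℂ q (cylinderMeasure n))) :
    HasRadonTransform u G := by
  obtain ⟨J, hJ⟩ : ∃ J : Lp ℂ q (polarMeasure n) →ₗᵢ[ℂ] Lp ℂ q (cylinderMeasure n),
      J = Lp.compMeasurePreservingₗᵢ ℂ polarMap measurePreserving_polarMap := ⟨_, rfl⟩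
  have hJx : ∀ H, (J H : ℝ × Sph n → ℂ) =ᵐ[cylinderMeasure n] fun z => H (polarMap z) := by
    intro H
    rw [hJ]
    exact Lp.coeFn_compMeasurePreserving H measurePreserving_polarMap
  rw [← hJ] at hG
  have hmem : ∀ G, G ∈ SinogramSpace n r t q := fun G => htop ▸ Submodule.mem_top
  -- The continuous map `h ↦ (⟨D⟩^{-s} h, J (U h))` sends Schwartz functions into the graph, hence
  -- by density sends `L^p` into its closure. That the sinogram space is everything makes the second
  -- component well defined.
  obtain ⟨Φ, hΦ, hΦ₁, hΦ₂⟩ : ∃ Φ : Lp ℂ p (volume : Measure (E n)) →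
      𝓢'(E n, ℂ) × SinogramSpace n r t q, Continuous Φ ∧
      (∀ h, (Φ h).1 = TemperedDistribution.besselPotential (E n) ℂ (-s) (h : 𝓢'(E n, ℂ))) ∧
      ∀ h, ((Φ h).2 : Lp ℂ q (cylinderMeasure n)) = J (U h) := by
    refine ⟨fun h => (TemperedDistribution.besselPotential (E n) ℂ (-s) (h : 𝓢'(E n, ℂ)),
      ⟨J (U h), hmem _⟩), Continuous.prodMk ?_ ?_, fun _ => rfl, fun _ => rfl⟩
    · exact (TemperedDistribution.besselPotential (E n) ℂ (-s)).continuous.comp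
        (Lp.toTemperedDistributionCLM ℂ volume p).continuous
    · exact Continuous.subtype_mk (J.continuous.comp U.continuous) _
  have hu' : TemperedDistribution.besselPotential (E n) ℂ (-s) (h : 𝓢'(E n, ℂ)) = u :=
    (TemperedDistribution.besselPotential_neg_apply_eq_iff s _ _).2 hu
  have hd : DenseRange fun φ : 𝓢(E n, ℂ) => φ.toLp p (volume : Measure (E n)) :=
    SchwartzMap.denseRange_toLpCLM (E := E n) (F := ℂ) hp
  have key := map_mem_closure (t := {x : 𝓢'(E n, ℂ) × SinogramSpace n r t q |
    ∃ f : 𝓢(E n, ℂ), x.1 = (f : 𝓢'(E n, ℂ)) ∧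
      ((x.2 : Lp ℂ q (cylinderMeasure n)) : ℝ × Sph n → ℂ)
        =ᵐ[cylinderMeasure n] weightedFourier r t (radon f)}) hΦ (hd h) ?_
  · have hΦh : Φ h = (u, G) := Prod.ext ((hΦ₁ h).trans hu') (Subtype.ext ((hΦ₂ h).trans hG))
    rwa [hΦh] at key
  rintro _ ⟨φ, rfl⟩
  have hg : (fun x : E n => (((1 + ‖x‖ ^ 2) ^ (-s / 2) : ℝ) : ℂ)).HasTemperateGrowth := by fun_prop
  refine ⟨SchwartzMap.fourierMultiplierCLM ℂ
    (fun x : E n => (((1 + ‖x‖ ^ 2) ^ (-s / 2) : ℝ) : ℂ)) φ, ?_, ?_⟩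
  · rw [hΦ₁, Lp.toTemperedDistribution_toLp_eq, TemperedDistribution.besselPotential,
      TemperedDistribution.fourierMultiplierCLM_toTemperedDistributionCLM_eq hg]
  · rw [weightedFourier_radon (SchwartzMap.integrable _), hΦ₂]
    refine (hJx _).trans ?_
    refine (measurePreserving_polarMap.quasiMeasurePreserving.ae_eq_comp (hU φ)).trans ?_
    refine Filter.Eventually.of_forall fun z => ?_
    simp only [Function.comp_apply]
    rw [← SchwartzMap.fourier_coe, SchwartzMap.fourierMultiplierCLM_apply,
      FourierTransform.fourier_fourierInv_eq, SchwartzMap.smulLeftCLM_apply_apply hg, smul_eq_mul]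

/-! ### Estimates for the Bessel norm as an infimum -/

theorem besselNorm_le {s : ℝ} {p : ℝ≥0∞} [Fact (1 ≤ p)] {u : 𝓢'(E n, ℂ)}
    {g : Lp ℂ p (volume : Measure (E n))}
    (h : TemperedDistribution.besselPotential (E n) ℂ s u = (g : 𝓢'(E n, ℂ))) :
    besselNorm s p u ≤ ‖g‖ₑ :=
  iInf₂_le g h

/-- Positivity of `C` matters when no representative exists: the infimum is then `∞`, and `C * ∞ =
∞` is needed. -/
theorem le_mul_besselNorm {s : ℝ} {p : ℝ≥0∞} [Fact (1 ≤ p)] {u : 𝓢'(E n, ℂ)} {a : ℝ≥0∞} {C : ℝ≥0}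
    (hC : 0 < C) (h : ∀ g : Lp ℂ p (volume : Measure (E n)),
      TemperedDistribution.besselPotential (E n) ℂ s u = (g : 𝓢'(E n, ℂ)) → a ≤ C * ‖g‖ₑ) :
    a ≤ C * besselNorm s p u := by
  have hC0 : (C : ℝ≥0∞) ≠ 0 := by exact_mod_cast hC.ne'
  rw [← ENNReal.div_le_iff' hC0 ENNReal.coe_ne_top]
  refine le_iInf₂ fun g hg => ?_
  rw [ENNReal.div_le_iff' hC0 ENNReal.coe_ne_top]
  exact h g hg

/-- The lift of `H` represents the Bessel potential of `u`. The constant `C + 1` replaces `C` so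
that it can be inverted. -/
theorem mul_besselNorm_le_of_polar {q : ℝ≥0∞} [Fact (1 ≤ q)] {σ t : ℝ} {C : ℝ≥0}
    {u : 𝓢'(E n, ℂ)} {H : Lp ℂ q (polarMeasure n)}
    (hH : ∀ φ : 𝓢(E n, ℂ), TemperedDistribution.besselPotential (E n) ℂ σ u φ =
      ∫ ξ, polarKernel n t φ ξ * H ξ ∂(polarMeasure n))
    (hC : ∃ g : Lp ℂ q (volume : Measure (E n)), ‖g‖ ≤ C * ‖H‖ ∧ ∀ φ : 𝓢(E n, ℂ),
      ∫ x, φ x * g x = ∫ ξ, polarKernel n t φ ξ * H ξ ∂(polarMeasure n)) :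
    (((C + 1)⁻¹ : ℝ≥0) : ℝ≥0∞) * besselNorm σ q u ≤ ‖H‖ₑ := by
  obtain ⟨g, hg, hgφ⟩ := hC
  have hu : TemperedDistribution.besselPotential (E n) ℂ σ u = (g : 𝓢'(E n, ℂ)) := by
    ext φ
    rw [hH, Lp.toTemperedDistribution_apply, ← hgφ]
    rfl
  have h1 : ‖g‖₊ ≤ (C + 1) * ‖H‖₊ := by
    rw [← NNReal.coe_le_coe]
    push_cast
    nlinarith [norm_nonneg H]
  have h2 : ‖g‖ₑ ≤ ((C + 1 : ℝ≥0) : ℝ≥0∞) * ‖H‖ₑ := by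
    rw [enorm_eq_nnnorm, enorm_eq_nnnorm]; exact_mod_cast h1
  have h3 : ((C + 1 : ℝ≥0) : ℝ≥0∞) ≠ 0 := by exact_mod_cast (by positivity : (C + 1 : ℝ≥0) ≠ 0)
  rw [ENNReal.coe_inv (by positivity), mul_comm, ← div_eq_mul_inv,
    ENNReal.div_le_iff' h3 ENNReal.coe_ne_top]
  exact (besselNorm_le hu).trans h2

end RadonBessel

/-! ### The main theorem -/

open RadonBessel in
theorem mainTheorem2 (n : ℕ) (hn : 1 ≤ n) (p p' : ℝ≥0∞) [Fact (1 ≤ p)] [Fact (1 ≤ p')]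
    (hpp' : p.HolderConjugate p') (hp : 1 < p) (hp2 : p ≤ 2)
    (s : ℝ) (hs : (n : ℝ) * (p'.toReal - 2) / p'.toReal ≤ s) :
    ∃ c C : ℝ≥0, 0 < c ∧ 0 < C ∧
      -- classical Radon transform of integrable functions
      (∀ (f : RadonBessel.E n → ℂ) (hf : Integrable f volume),
        (c : ℝ≥0∞) * RadonBessel.besselNorm (s - (n : ℝ) * (p'.toReal - 2) / p'.toReal) p'
              (Lp.toTemperedDistribution (hf.toL1 f))
            ≤ RadonBessel.sinogramNorm (s + ((n : ℝ) - 1) / p'.toReal)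
                (((n : ℝ) * p'.toReal - n - 1) / p'.toReal) p' (RadonBessel.radon f) ∧
          RadonBessel.sinogramNorm (s + ((n : ℝ) - 1) / p'.toReal)
                (((n : ℝ) * p'.toReal - n - 1) / p'.toReal) p' (RadonBessel.radon f)
            ≤ (C : ℝ≥0∞) * RadonBessel.besselNorm s p
                (Lp.toTemperedDistribution (hf.toL1 f))) ∧
      -- every element of the Bessel potential space has exactly one Radon transform
      (∀ u : 𝓢'(RadonBessel.E n, ℂ), TemperedDistribution.MemSobolev s p u →
        ∃! G : RadonBessel.SinogramSpace n (s + ((n : ℝ) - 1) / p'.toReal)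
            (((n : ℝ) * p'.toReal - n - 1) / p'.toReal) p',
          RadonBessel.HasRadonTransform u G) ∧
      -- the bounds for the Radon transform in the sinogram space
      (∀ (u : 𝓢'(RadonBessel.E n, ℂ))
          (G : RadonBessel.SinogramSpace n (s + ((n : ℝ) - 1) / p'.toReal)
            (((n : ℝ) * p'.toReal - n - 1) / p'.toReal) p'),
        RadonBessel.HasRadonTransform u G →
          (c : ℝ≥0∞) * RadonBessel.besselNorm (s - (n : ℝ) * (p'.toReal - 2) / p'.toReal) p' u
              ≤ ‖G‖ₑ ∧
            ‖G‖ₑ ≤ (C : ℝ≥0∞) * RadonBessel.besselNorm s p u) := by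
  obtain ⟨hc, hP1, hP2, hQ2, hptop, hqtop⟩ := holderConjugate_toReal_of_one_lt hpp' hp hp2
  have hQ0 : 0 < p'.toReal := by linarith
  -- From `p' ≥ 2` the numerator is at least `n - 1`; this nonnegativity makes the weight
  -- continuous.
  have ht : 0 ≤ ((n : ℝ) * p'.toReal - n - 1) / p'.toReal := by
    have : (1 : ℝ) ≤ n := by exact_mod_cast hn
    exact div_nonneg (by nlinarith) hQ0.le
  -- The order on the left of the theorem is `r - t`, the order of the Bessel potential in the
  -- pairing identity.
  have hσ : s - (n : ℝ) * (p'.toReal - 2) / p'.toReal =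
      s + ((n : ℝ) - 1) / p'.toReal - ((n : ℝ) * p'.toReal - n - 1) / p'.toReal := by
    field_simp; ring
  obtain ⟨K, hK⟩ := exists_eLpNorm_polarKernel_le hn hpp' hp hp2
  obtain ⟨C, hC⟩ := exists_Lp_repr_polarKernel hn hpp' hp hp2
  obtain ⟨U, hU⟩ := exists_vWeight_fourier_extension hn hpp' hp hp2 s
  rw [hσ]
  clear hσ hs
  generalize s + ((n : ℝ) - 1) / p'.toReal = r at *
  generalize ((n : ℝ) * p'.toReal - n - 1) / p'.toReal = t at *
  have hk : ∀ φ : 𝓢(E n, ℂ), MemLp (polarKernel n t φ) p (polarMeasure n) := fun φ =>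
    ⟨(measurable_polarKernel t φ).aestronglyMeasurable,
      (hK φ).trans_lt (ENNReal.mul_lt_top ENNReal.coe_lt_top (φ.memLp p volume).2)⟩
  have hint : ∀ (H : Lp ℂ p' (polarMeasure n)) (φ : 𝓢(E n, ℂ)),
      Integrable (fun ξ => polarKernel n t φ ξ * H ξ) (polarMeasure n) := fun H φ =>
    (hk φ).integrable_mul (Lp.memLp H)
  have htop : SinogramSpace n r t p' = ⊤ := sinogramSpace_eq_top r ht hqtop
  obtain ⟨J, hJ⟩ : ∃ J : Lp ℂ p' (polarMeasure n) →ₗᵢ[ℂ] Lp ℂ p' (cylinderMeasure n),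
      J = Lp.compMeasurePreservingₗᵢ ℂ polarMap measurePreserving_polarMap := ⟨_, rfl⟩
  have hpolar : ∀ (u : 𝓢'(E n, ℂ)) (G : SinogramSpace n r t p'), HasRadonTransform u G →
      ∃ H : Lp ℂ p' (polarMeasure n), J H = (G : Lp ℂ p' (cylinderMeasure n)) ∧
        ∀ φ : 𝓢(E n, ℂ), TemperedDistribution.besselPotential (E n) ℂ (r - t) u φ =
          ∫ ξ, polarKernel n t φ ξ * H ξ ∂(polarMeasure n) := fun u G h => by
    rw [hJ]; exact exists_polar_of_hasRadonTransform hn hpp' hk h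
  have hexists : ∀ (u : 𝓢'(E n, ℂ)) (h : Lp ℂ p (volume : Measure (E n))),
      TemperedDistribution.besselPotential (E n) ℂ s u = (h : 𝓢'(E n, ℂ)) →
      HasRadonTransform u (⟨J (U h), htop ▸ Submodule.mem_top⟩ : SinogramSpace n r t p') :=
    fun u h hu => hasRadonTransform_of_besselPotential_eq hptop htop hU hu (by rw [hJ])
  have hunique : ∀ (u : 𝓢'(E n, ℂ)) (G G' : SinogramSpace n r t p'),
      HasRadonTransform u G → HasRadonTransform u G' → G = G' := by
    intro u G G' h h'
    obtain ⟨H, hH, hHφ⟩ := hpolar u G h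
    obtain ⟨H', hH', hHφ'⟩ := hpolar u G' h'
    have : H = H' := Lp.ext (ae_eq_of_integral_polarKernel_mul_eq hn t (hint H) (hint H')
      fun φ => (hHφ φ).symm.trans (hHφ' φ))
    exact Subtype.ext (by rw [← hH, ← hH', this])
  have hUle : ∀ h, ‖U h‖ₑ ≤ ((‖U‖₊ + 1 : ℝ≥0) : ℝ≥0∞) * ‖h‖ₑ := by
    intro h
    have h1 : ‖U h‖₊ ≤ (‖U‖₊ + 1) * ‖h‖₊ := by
      refine (U.le_opNNNorm h).trans ?_
      gcongr
      exact le_self_add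
    rw [enorm_eq_nnnorm, enorm_eq_nnnorm]
    exact_mod_cast h1
  have hJe : ∀ H, ‖J H‖ₑ = ‖H‖ₑ := fun H => by
    rw [enorm_eq_nnnorm, enorm_eq_nnnorm, J.nnnorm_map]
  refine ⟨(C + 1)⁻¹, ‖U‖₊ + 1, by positivity, by positivity, fun f hf => ?_, fun u hu => ?_,
    fun u G hG => ?_⟩
  · have hmeas := (measurable_vWeight_mul_fourier r t hf).aestronglyMeasurable
      (μ := polarMeasure n)
    have hB := besselPotential_toL1_eq_integral_polarKernel hn r t hf
    rw [sinogramNorm_radon hf r t hpp'.symm.ne_zero hqtop]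
    refine ⟨?_, le_mul_besselNorm (by positivity) fun h hh => ?_⟩
    · by_cases htop' : eLpNorm (fun ξ => (vWeight r t ξ : ℂ) * 𝓕 f ξ) p' (polarMeasure n) = ∞
      · rw [htop']; exact le_top
      have hm : MemLp (fun ξ => (vWeight r t ξ : ℂ) * 𝓕 f ξ) p' (polarMeasure n) :=
        ⟨hmeas, lt_top_iff_ne_top.2 htop'⟩
      rw [← Lp.enorm_toLp hm]
      refine mul_besselNorm_le_of_polar (fun φ => (hB φ).2.trans (integral_congr_ae ?_))
        (hC hm.toLp)
      filter_upwards [hm.coeFn_toLp] with ξ hξ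
      rw [hξ]
    -- If `⟨D⟩^s f = h ∈ L^p`, the polar density `U h` and the classical `v 𝓕 f` have the same
    -- pairings with all kernels, so they agree almost everywhere and the bound for `U` applies.
    · obtain ⟨H, hH, hHφ⟩ := hpolar _ _ (hexists _ h hh)
      have hUH : H = U h := J.injective hH
      have hae := ae_eq_of_integral_polarKernel_mul_eq hn t (hint H) (fun φ => (hB φ).1)
        fun φ => (hHφ φ).symm.trans (hB φ).2
      rw [← eLpNorm_congr_ae hae, ← Lp.enorm_def, hUH]
      exact hUle h
  · obtain ⟨h, hh⟩ := hu
    exact ⟨_, hexists u h hh, fun G hG => hunique u _ _ hG (hexists u h hh)⟩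
  · refine ⟨?_, le_mul_besselNorm (by positivity) fun h hh => ?_⟩
    · obtain ⟨H, hH, hHφ⟩ := hpolar u G hG
      have hGH : ‖G‖ₑ = ‖H‖ₑ := by rw [← hJe, hH]; rfl
      rw [hGH]
      exact mul_besselNorm_le_of_polar hHφ (hC H)
    · rw [hunique u G _ hG (hexists u h hh)]
      exact (hJe (U h)).trans_le (hUle h)
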